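/- **Setting.** Let $\mathcal S,\mathcal A$ be finite with $|\mathcal S||\mathcal A|\ge 2$, let $P_a(i,j)$ be transition probabilities, $\gamma\in(0,1)$, rewards $\hat r_{ija}\in[0,1]$ almost surely, $r_{ia}=\sum_j P_a(i,j)\,\mathbb E[\hat r_{ija}]$ the expected reward, and $\xi=\frac1{|\mathcal S|}\mathbf 1$. Put $\mathcal L=\{\lambda\in\mathbb R^{\mathcal S\times\mathcal A}:\lambda\ge 0,\ \|\lambda\|_1=(1-\gamma)^{-1}\}$. Let $\rho$ be a real-valued convex function on a convex set containing $\mathcal L$, with $\partial\rho(\lambda)\ne\emptyset$ and $\|u\|_\infty\le\sigma$ for all $\lambda\in\mathcal L$, $u\in\partial\rho(\lambda)$, and let $c>0$. Let $\lambda^*$ be a maximizer of $\langle\lambda,r\rangle-c\rho(\lambda)$ over all $\lambda\in\mathcal L$ with $\sum_a(I-\gamma P_a^\top)\lambda_a=\xi$. **Algorithm.** Fix $T\ge1$, $\delta\in(0,\frac12)$, $M_1=\frac{4(1+c\sigma)}{1-\gamma}$, $M_2=c\sigma$, $\beta=\frac{1-\gamma}{1+c\sigma}\sqrt{\frac{\log(|\mathcal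 S||\mathcal A|)}{T|\mathcal S||\mathcal A|}}$, $\alpha=\sqrt{|\mathcal S|/T}\,(1+c\sigma)$ and $\mathcal V=\{v\in\mathbb R^{\mathcal S}:\|v\|_\infty\le 2\frac{1+c\sigma}{1-\gamma}\}$. Start from an arbitrary $v^1\in\mathcal V$ and $\lambda^1=\frac{1}{|\mathcal S||\mathcal A|(1-\gamma)}\mathbf 1$. For $t=1,\dots,T$: let $\zeta^t=(1-\delta)(1-\gamma)\lambda^t+\frac{\delta}{|\mathcal S||\mathcal A|}\mathbf 1$; given the past, draw $(s_t,a_t)\sim\zeta^t$ and, independently, $\bar s_t\sim\xi$; then draw $s_t'\sim P_{a_t}(s_t,\cdot)$ and the reward $\hat r_{s_ts_t'a_t}$; draw a random vector $g^t$ with $\|g^t\|_\infty\le\sigma$ whose conditional mean given the past lies in $\partial\rho(\lambda^t)$. With $\mathbf e_s$ the coordinate vectors and $\mathbf E_{s,a}$ the coordinate matrices, put $$G^t=\mathbf e_{\bar s_t}+\frac{\lambda^t_{s_ta_t}}{\zeta^t_{s_ta_t}}(\gamma\mathbf e_{s_t'}-\mathbf e_{s_t}),\qquad \Delta^t=\frac{\hat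 r_{s_ts_t'a_t}+\gamma v^t_{s_t'}-v^t_{s_t}-M_1}{\zeta^t_{s_ta_t}}\mathbf E_{s_t,a_t}-c\,g^t-M_2\mathbf 1,$$ let $v^{t+1}$ be the Euclidean projection of $v^t-\alpha G^t$ onto $\mathcal V$, let $$\lambda^{t+\frac12}=\operatorname*{argmax}_{\lambda\ge0}\ \langle\Delta^t,\lambda-\lambda^t\rangle-\frac{1}{(1-\gamma)\beta}KL\big((1-\gamma)\lambda\,\|\,(1-\gamma)\lambda^t\big),\qquad KL(p\|q)=\sum_{s,a}p_{sa}\log\frac{p_{sa}}{q_{sa}},$$ and $\lambda^{t+1}=\lambda^{t+\frac12}/\big((1-\gamma)\|\lambda^{t+\frac12}\|_1\big)$. The output is $\bar\lambda=\frac1T\sum_{t=1}^T\lambda^t$. **Theorem.** There is a universal constant $K>0$ such that in this setting, for every $\epsilon>0$ and every $$T\ \ge\ K\,\frac{|\mathcal S||\mathcal A|\log(|\mathcal S||\mathcal A|)(1+2c\sigma)^2}{(1-\gamma)^4\epsilon^2},$$ the output satisfies $\bar\lambda\ge0$ and $\|\bar\lambda\|_1=(1-\gamma)^{-1}$, $$\mathbb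 E\Big\|\sum_{a\in\mathcal A}(I-\gamma P_a^\top)\bar\lambda_a-\xi\Big\|_1\le\frac{(1-\gamma)\epsilon}{1+c\sigma}\le(1-\gamma)\epsilon,$$ and $$\mathbb E\big[(\langle\lambda^*,r\rangle-c\rho(\lambda^*))-(\langle\bar\lambda,r\rangle-c\rho(\bar\lambda))\big]\le\epsilon .$$ -/

import Mathlib

open MeasureTheory

noncomputable section

namespace CautiousRL

/-- A finite discounted Markov decision process. `P a i j` is the probability of moving from `i` to
`j` under action `a`. Rewards may be random: `rewardLaw i j a` is the law of the reward revealed on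
the transition `i → j` under action `a` (a Dirac mass when the reward is a function of `i, j, a`);
rewards lie in `[0, 1]` with probability one. -/
structure MDP (S A : Type*) [Fintype S] where
  /-- transition probabilities -/
  P : A → S → S → ℝ
  P_nonneg : ∀ a i j, 0 ≤ P a i j
  P_sum : ∀ a i, ∑ j, P a i j = 1
  /-- laws of the rewards -/
  rewardLaw : S → S → A → Measure ℝ
  rewardLaw_prob : ∀ i j a, IsProbabilityMeasure (rewardLaw i j a)
  rewardLaw_mem : ∀ i j a, ∀ᵐ x ∂(rewardLaw i j a), x ∈ Set.Icc (0 : ℝ) 1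
  /-- discount factor -/
  γ : ℝ
  γ_pos : 0 < γ
  γ_lt_one : γ < 1

variable {S A : Type*} [Fintype S] [Fintype A]

/-- The expected reward `r_{ia}`. -/
def MDP.r (M : MDP S A) (i : S) (a : A) : ℝ :=
  ∑ j, M.P a i j * ∫ x, x ∂(M.rewardLaw i j a)

/-- The inner product `⟨x, y⟩` of two `S × A` arrays. -/
def ip (x y : S → A → ℝ) : ℝ := ∑ s, ∑ a, x s a * y s a

/-- `‖x‖₁` for `S × A` arrays. -/
def norm1 (x : S → A → ℝ) : ℝ := ∑ s, ∑ a, |x s a|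

/-- The uniform initial distribution `ξ`. -/
def xi (S : Type*) [Fintype S] (_ : S) : ℝ := 1 / (Fintype.card S : ℝ)

/-- The vector `∑ₐ (I - γ Pₐᵀ) λₐ - ξ`. -/
def MDP.flowResidual (M : MDP S A) (lam : S → A → ℝ) (s : S) : ℝ :=
  (∑ a, (lam s a - M.γ * ∑ i, M.P a i s * lam i a)) - xi S s

/-- The `ℓ¹` norm of the violation of the flow constraint. -/
def MDP.violation (M : MDP S A) (lam : S → A → ℝ) : ℝ := ∑ s, |M.flowResidual lam s|

/-- The set `𝓛 = {λ ≥ 0, ‖λ‖₁ = (1 - γ)⁻¹}`. -/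
def dualSet (S A : Type*) [Fintype S] [Fintype A] (γ : ℝ) : Set (S → A → ℝ) :=
  {lam | (∀ s a, 0 ≤ lam s a) ∧ norm1 lam = (1 - γ)⁻¹}

/-- The feasible set of the caution-sensitive problem. -/
def MDP.feasible (M : MDP S A) : Set (S → A → ℝ) :=
  {lam | lam ∈ dualSet S A M.γ ∧ ∀ s, M.flowResidual lam s = 0}

/-- The cautious objective `⟨λ, r⟩ - c ρ(λ)`. -/
def MDP.objective (M : MDP S A) (c : ℝ) (ρ : (S → A → ℝ) → ℝ) (lam : S → A → ℝ) : ℝ :=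
  ip lam M.r - c * ρ lam

/-- `lam` is an optimal solution of the caution-sensitive problem. -/
def MDP.IsOptimal (M : MDP S A) (c : ℝ) (ρ : (S → A → ℝ) → ℝ) (lam : S → A → ℝ) : Prop :=
  lam ∈ M.feasible ∧ ∀ k ∈ M.feasible, M.objective c ρ k ≤ M.objective c ρ lam

/-- The subdifferential at `x` of a function `ρ` with effective domain `D`. -/
def subdiff (D : Set (S → A → ℝ)) (ρ : (S → A → ℝ) → ℝ) (x : S → A → ℝ) : Set (S → A → ℝ) :=
  {u | ∀ y ∈ D, ρ x + ip u (y - x) ≤ ρ y}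

/-- The caution function `ρ` is convex on a convex domain `D ⊇ 𝓛`, it has a subgradient at every
point of `𝓛`, and all its subgradients on `𝓛` are bounded by `σ` in the maximum norm. -/
structure IsCaution (γ : ℝ) (D : Set (S → A → ℝ)) (ρ : (S → A → ℝ) → ℝ) (σ : ℝ) : Prop where
  dom : dualSet S A γ ⊆ D
  convex : ConvexOn ℝ D ρ
  nonempty : ∀ lam ∈ dualSet S A γ, (subdiff D ρ lam).Nonempty
  bound : ∀ lam ∈ dualSet S A γ, ∀ u ∈ subdiff D ρ lam, ∀ s a, |u s a| ≤ σ

/-- The shift `M₁ = 4 (1 + c σ) / (1 - γ)`. -/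
def shift₁ (γ c σ : ℝ) : ℝ := 4 * (1 + c * σ) / (1 - γ)

/-- The shift `M₂ = c σ`. -/
def shift₂ (c σ : ℝ) : ℝ := c * σ

/-- The number `|S| |A|`. -/
def numSA (S A : Type*) [Fintype S] [Fintype A] : ℝ :=
  (Fintype.card S : ℝ) * (Fintype.card A : ℝ)

/-- The dual step size `β`. -/
def stepβ (S A : Type*) [Fintype S] [Fintype A] (γ c σ : ℝ) (T : ℕ) : ℝ :=
  (1 - γ) / (1 + c * σ) * √(Real.log (numSA S A) / (T * numSA S A))

/-- The primal step size `α`. -/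
def stepα (S : Type*) [Fintype S] (c σ : ℝ) (T : ℕ) : ℝ :=
  √((Fintype.card S : ℝ) / T) * (1 + c * σ)

/-- The box `𝓥 = {v : ‖v‖_∞ ≤ 2 (1 + c σ) / (1 - γ)}`. -/
def primalSet (S : Type*) (γ c σ : ℝ) : Set (S → ℝ) :=
  {v | ∀ s, |v s| ≤ 2 * ((1 + c * σ) / (1 - γ))}

/-- `w` is the Euclidean projection of `y` onto `V`. -/
def IsProj (V : Set (S → ℝ)) (y w : S → ℝ) : Prop :=
  w ∈ V ∧ ∀ z ∈ V, ∑ s, (w s - y s) ^ 2 ≤ ∑ s, (z s - y s) ^ 2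

/-- The sampling distribution `ζ = (1 - δ)(1 - γ) λ + δ / (|S| |A|)`. -/
def zeta (γ δ : ℝ) (lam : S → A → ℝ) (s : S) (a : A) : ℝ :=
  (1 - δ) * (1 - γ) * lam s a + δ / numSA S A

/-- The coordinate vector `e_s`. -/
def e [DecidableEq S] (s : S) (x : S) : ℝ := if x = s then 1 else 0

/-- The stochastic primal gradient at `λ` built from a sample `(s, a, s', sbar)`. -/
def gradV [DecidableEq S] (γ δ : ℝ) (lam : S → A → ℝ) (s : S) (a : A) (s' sbar : S) (x : S) : ℝ :=
  e sbar x + if 0 < zeta γ δ lam s a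
    then lam s a / zeta γ δ lam s a * (γ * e s' x - e s x) else 0

/-- The shifted stochastic dual supergradient at `(v, λ)` built from a sample `(s, a, s')` with
revealed reward `rew` and from a stochastic subgradient `g` of `ρ`. -/
def gradLam [DecidableEq S] [DecidableEq A] (γ δ c σ : ℝ) (v : S → ℝ) (lam : S → A → ℝ)
    (s : S) (a : A) (s' : S) (rew : ℝ) (g : S → A → ℝ) (x : S) (y : A) : ℝ :=
  (if x = s ∧ y = a ∧ 0 < zeta γ δ lam s a
    then (rew + γ * v s' - v s - shift₁ γ c σ) / zeta γ δ lam s a else 0)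
    - c * g x y - shift₂ c σ

/-- `KL(p ‖ q) = ∑ p log (p / q)` for nonnegative arrays `p` and positive arrays `q`. -/
def KL (p q : S → A → ℝ) : ℝ := ∑ s, ∑ a, p s a * Real.log (p s a / q s a)

/-- The objective of the proximal dual subproblem with supergradient `Δ` at `λ`. -/
def proxObjective (γ β : ℝ) (Δ lam h : S → A → ℝ) : ℝ :=
  ip Δ (h - lam) - 1 / ((1 - γ) * β) * KL ((1 - γ) • h) ((1 - γ) • lam)

/-- One dual update: `lam'` is the normalization of a maximizer `h` of the proximal subproblem
over the nonnegative arrays (the domain of `KL`). -/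
def IsDualStep (γ β : ℝ) (Δ lam lam' : S → A → ℝ) : Prop :=
  ∃ h : S → A → ℝ, (∀ s a, 0 ≤ h s a) ∧
    (∀ k : S → A → ℝ, (∀ s a, 0 ≤ k s a) →
      proxObjective γ β Δ lam k ≤ proxObjective γ β Δ lam h) ∧
    ∀ s a, lam' s a = h s a / ((1 - γ) * norm1 h)

/-- A run of `T` iterations of the stochastic primal-dual method with the prescribed parameters on
a probability space `(Ω, μ)`. Iterations are numbered `0, …, T - 1`; the σ-algebra `ℱ t` is the
information available before the sampling of iteration `t`. -/
structure Run [DecidableEq S] [DecidableEq A] (M : MDP S A) (c σ δ : ℝ)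
    (D : Set (S → A → ℝ)) (ρ : (S → A → ℝ) → ℝ) (T : ℕ)
    {Ω : Type*} [mΩ : MeasurableSpace Ω] (μ : Measure Ω) where
  /-- the history -/
  ℱ : Filtration ℕ mΩ
  /-- primal iterates -/
  v : ℕ → Ω → S → ℝ
  /-- dual iterates -/
  lam : ℕ → Ω → S → A → ℝ
  /-- sampled states -/
  st : ℕ → Ω → S
  /-- sampled actions -/
  act : ℕ → Ω → A
  /-- generated next states -/
  nxt : ℕ → Ω → S
  /-- generated rewards -/
  rew : ℕ → Ω → ℝ
  /-- states sampled from `ξ` -/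
  sbar : ℕ → Ω → S
  /-- stochastic subgradients of `ρ` -/
  g : ℕ → Ω → S → A → ℝ
  v_adapted : ∀ t, t ≤ T → Measurable[ℱ t] (v t)
  lam_adapted : ∀ t, t ≤ T → Measurable[ℱ t] (lam t)
  st_meas : ∀ t, t < T → ∀ s, MeasurableSet[ℱ (t + 1)] {ω | st t ω = s}
  act_meas : ∀ t, t < T → ∀ a, MeasurableSet[ℱ (t + 1)] {ω | act t ω = a}
  nxt_meas : ∀ t, t < T → ∀ s, MeasurableSet[ℱ (t + 1)] {ω | nxt t ω = s}
  rew_meas : ∀ t, t < T → Measurable[ℱ (t + 1)] (rew t)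
  sbar_meas : ∀ t, t < T → ∀ s, MeasurableSet[ℱ (t + 1)] {ω | sbar t ω = s}
  g_meas : ∀ t, t < T → Measurable[ℱ (t + 1)] (g t)
  /-- arbitrary start in `𝓥` -/
  v_init : ∀ ω, v 0 ω ∈ primalSet S M.γ c σ
  /-- uniform start -/
  lam_init : ∀ ω s a, lam 0 ω s a = 1 / (numSA S A * (1 - M.γ))
  /-- Given the history, `(s_t, a_t) ∼ ζ^t` and the independent `sbar_t ∼ ξ` are drawn, then the next
  state from the transition law and the reward from its law. -/
  sample_law : ∀ t, t < T → ∀ (s : S) (a : A) (s' s₀ : S) (B : Set ℝ), MeasurableSet B →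
    μ[Set.indicator {ω | st t ω = s ∧ act t ω = a ∧ nxt t ω = s' ∧ rew t ω ∈ B ∧ sbar t ω = s₀}
        (fun _ => (1 : ℝ)) | ℱ t]
      =ᵐ[μ] fun ω => zeta M.γ δ (lam t ω) s a * M.P a s s' * (M.rewardLaw s s' a).real B * xi S s₀
  /-- the stochastic subgradients are bounded by `σ` -/
  g_bound : ∀ t, t < T → ∀ᵐ ω ∂μ, ∀ s a, |g t ω s a| ≤ σ
  /-- the stochastic subgradients are unbiased -/
  g_unbiased : ∀ t, t < T →
    ∀ᵐ ω ∂μ, (fun s a => (μ[fun ω' => g t ω' s a | ℱ t]) ω) ∈ subdiff D ρ (lam t ω)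
  /-- the primal update -/
  v_step : ∀ t, t < T → ∀ ω, IsProj (primalSet S M.γ c σ)
    (fun x => v t ω x - stepα S c σ T *
      gradV M.γ δ (lam t ω) (st t ω) (act t ω) (nxt t ω) (sbar t ω) x)
    (v (t + 1) ω)
  /-- the dual update -/
  lam_step : ∀ t, t < T → ∀ ω, IsDualStep M.γ (stepβ S A M.γ c σ T)
    (gradLam M.γ δ c σ (v t ω) (lam t ω) (st t ω) (act t ω) (nxt t ω) (rew t ω) (g t ω))
    (lam t ω) (lam (t + 1) ω)

/-- The averaged dual output `(1 / T) ∑ λ^t`. -/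
def Run.avg [DecidableEq S] [DecidableEq A] {M : MDP S A} {c σ δ : ℝ}
    {D : Set (S → A → ℝ)} {ρ : (S → A → ℝ) → ℝ} {T : ℕ}
    {Ω : Type*} [MeasurableSpace Ω] {μ : Measure Ω} (R : Run M c σ δ D ρ T μ)
    (ω : Ω) (s : S) (a : A) : ℝ :=
  1 / (T : ℝ) * ∑ t ∈ Finset.range T, R.lam t ω s a

end CautiousRL

end

set_option linter.unusedSectionVars false

namespace CautiousRL

/-! ### Pathwise analysis of the two update rules. -/

section Deterministic

/-! The method plays the game with payoff L(v, λ) = ⟨λ, r⟩ - cρ(λ) - ⟨v, res λ⟩, where res is the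
flow residual: exponential weights maximize over λ, projected gradient descent minimizes over v. Put
B = (1 + cσ)/(1 - γ), so that the box for v has radius 2B, and n = |S||A|. Adding the two regrets,
with a feasible comparator k for λ and z = 2B · sign(res of the average) for v, and using Jensen's
inequality, bounds the gap objective(k) - objective(average) + 2B · violation(average)
(`Run.gap_le`). In expectation, T times this gap is at most a constant times (1 + cσ)(1 - γ)⁻² √(T n
log n) (`Run.integral_gap_le`), which the lower bound on T turns into Tε/2.

Three points keep δ and stray factors of n out of the rate. The shifts make the dual supergradient
nonpositive, so the quadratic bound on exp holds however large the importance weights are; they cost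
nothing, because in conditional mean they pair to zero with differences of arrays of equal mass. The
second moment is weighted by λ: one factor λ/ζ is at most 2/(1 - γ), and the remaining 1/ζ has mean
exactly n (`Run.integral_inv_zeta`). Finally z depends on the whole run, so its product with the
gradient noise is not centred; it is handled by a Young inequality and the orthogonality of the
noise increments (`Run.integral_sq_sum_noise_le`).

Dropping the violation term gives the objective bound. For the violation, replacing the state
marginal of λ by the discounted occupancy of the same policy gives a feasible array at ℓ¹ distance
at most violation/(1 - γ). Hence the objective at λ exceeds the feasible supremum by at most B ·
violation (`MDP.exists_feasible_objective_ge`). The gap carries 2B · violation, so one surplus copy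
of B · violation is controlled. -/

lemma convex_primalSet (S : Type*) (γ c σ : ℝ) : Convex ℝ (primalSet S γ c σ) := by
  intro x hx y hy p q hp hq hpq s
  simp only [Pi.add_apply, Pi.smul_apply, smul_eq_mul]
  calc |p * x s + q * y s| ≤ p * |x s| + q * |y s| := by
        refine (abs_add_le _ _).trans ?_
        rw [abs_mul, abs_mul, abs_of_nonneg hp, abs_of_nonneg hq]
    _ ≤ p * (2 * ((1 + c * σ) / (1 - γ))) + q * (2 * ((1 + c * σ) / (1 - γ))) :=
        add_le_add (mul_le_mul_of_nonneg_left (hx s) hp) (mul_le_mul_of_nonneg_left (hy s) hq)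
    _ = 2 * ((1 + c * σ) / (1 - γ)) := by rw [← add_mul, hpq, one_mul]

variable {S A : Type*} [Fintype S] [Fintype A]

lemma norm1_of_nonneg {x : S → A → ℝ} (hx : ∀ s a, 0 ≤ x s a) :
    norm1 x = ∑ s, ∑ a, x s a := by
  simp only [norm1, abs_of_nonneg (hx _ _)]

lemma sum_of_mem_dualSet {γ : ℝ} {x : S → A → ℝ} (hx : x ∈ dualSet S A γ) :
    ∑ s, ∑ a, x s a = (1 - γ)⁻¹ := by
  rw [← norm1_of_nonneg hx.1, hx.2]

lemma abs_ip_le {u y : S → A → ℝ} {b : ℝ} (hu : ∀ s a, |u s a| ≤ b) :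
    |ip u y| ≤ b * norm1 y := by
  simp only [ip, norm1, Finset.mul_sum]
  refine (Finset.abs_sum_le_sum_abs _ _).trans (Finset.sum_le_sum fun s _ => ?_)
  refine (Finset.abs_sum_le_sum_abs _ _).trans (Finset.sum_le_sum fun a _ => ?_)
  rw [abs_mul]
  exact mul_le_mul_of_nonneg_right (hu s a) (abs_nonneg _)

lemma norm1_sub_comm (x y : S → A → ℝ) : norm1 (x - y) = norm1 (y - x) := by
  simp only [norm1, Pi.sub_apply, abs_sub_comm]

lemma ip_sub_right (u x y : S → A → ℝ) : ip u (x - y) = ip u x - ip u y := by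
  simp only [ip, Pi.sub_apply, mul_sub, Finset.sum_sub_distrib]

lemma ip_add_left (u w x : S → A → ℝ) : ip (u + w) x = ip u x + ip w x := by
  simp only [ip, Pi.add_apply, add_mul, Finset.sum_add_distrib]

lemma ip_comm (x y : S → A → ℝ) : ip x y = ip y x := by
  simp only [ip, mul_comm]

/-! ### The entropic proximal step -/

lemma sub_le_mul_log_div {x y : ℝ} (hx : 0 ≤ x) (hy : 0 < y) :
    x - y ≤ x * Real.log (x / y) := by
  rcases hx.eq_or_lt with rfl | hx
  · simp [hy.le]
  · have h := Real.log_le_sub_one_of_pos (div_pos hy hx)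
    have h2 : Real.log (x / y) = - Real.log (y / x) := by
      rw [← Real.log_inv, inv_div]
    rw [h2]
    have h3 := mul_le_mul_of_nonneg_left h hx.le
    have h4 : x * (y / x - 1) = y - x := by field_simp
    linarith

lemma eq_of_mul_log_div_eq_sub {x y : ℝ} (hx : 0 ≤ x) (hy : 0 < y)
    (h : x * Real.log (x / y) = x - y) : x = y := by
  rcases hx.eq_or_lt with rfl | hx
  · simp at h
    exact h.symm
  · by_contra hne
    have hne' : y / x ≠ 1 := fun h1 => hne ((div_eq_one_iff_eq hx.ne').1 h1).symm
    have h1 := Real.log_lt_sub_one_of_pos (div_pos hy hx) hne'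
    have h2 : Real.log (x / y) = - Real.log (y / x) := by
      rw [← Real.log_inv, inv_div]
    have h3 := mul_lt_mul_of_pos_left h1 hx
    have h4 : x * (y / x - 1) = y - x := by field_simp
    rw [h2] at h
    linarith

/-- The unnormalized maximizer of the entropic proximal subproblem. -/
noncomputable def expStep (β : ℝ) (Δ lam : S → A → ℝ) (s : S) (a : A) : ℝ :=
  lam s a * Real.exp (β * Δ s a - 1)

/-- The linear term can be absorbed into the logarithm. What remains is separable and, up to
constants, minus the generalized relative entropy of `h` with respect to `expStep`. -/
lemma proxObjective_eq {γ β : ℝ} (hγ : γ < 1) (hβ : 0 < β) {Δ lam h : S → A → ℝ}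
    (hlam : ∀ s a, 0 < lam s a) (hh : ∀ s a, 0 ≤ h s a) :
    proxObjective γ β Δ lam h =
      β⁻¹ * ∑ s, ∑ a, (h s a - h s a * Real.log (h s a / expStep β Δ lam s a)) - ip Δ lam := by
  have hg : (1 - γ) ≠ 0 := by linarith
  unfold proxObjective
  rw [ip_sub_right]
  have key : ip Δ h - 1 / ((1 - γ) * β) * KL ((1 - γ) • h) ((1 - γ) • lam) =
      β⁻¹ * ∑ s, ∑ a, (h s a - h s a * Real.log (h s a / expStep β Δ lam s a)) := by
    simp only [ip, KL, Finset.mul_sum, ← Finset.sum_sub_distrib]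
    refine Finset.sum_congr rfl fun s _ => Finset.sum_congr rfl fun a _ => ?_
    simp only [Pi.smul_apply, smul_eq_mul]
    rw [mul_div_mul_left _ _ hg]
    rcases (hh s a).eq_or_lt with h0 | h0
    · simp [← h0]
    · have hl := hlam s a
      have : Real.log (h s a / expStep β Δ lam s a) =
          Real.log (h s a / lam s a) - (β * Δ s a - 1) := by
        rw [expStep, ← div_div, Real.log_div (by positivity) (by positivity), Real.log_exp]
      rw [this]
      field_simp
      ring
  linarith

/-- By x - y ≤ x log(x/y), every coordinate of the rewritten objective is at most the value attained
at `expStep`, with equality only there. A maximizer therefore agrees with `expStep` in each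
coordinate, and normalization cancels the factor e⁻¹. -/
lemma IsDualStep.eq [Nonempty S] [Nonempty A] {γ β : ℝ} (hγ : γ < 1) (hβ : 0 < β)
    {Δ lam lam' : S → A → ℝ} (hlam : ∀ s a, 0 < lam s a) (h : IsDualStep γ β Δ lam lam') (s : S)
    (a : A) :
    lam' s a = lam s a * Real.exp (β * Δ s a) /
      ((1 - γ) * ∑ s, ∑ a, lam s a * Real.exp (β * Δ s a)) := by
  obtain ⟨k, hk0, hmax, hlam'⟩ := h
  have hpos : ∀ s a, 0 < expStep β Δ lam s a := fun s a => mul_pos (hlam s a) (Real.exp_pos _)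
  have h1 := hmax _ (fun s a => (hpos s a).le)
  rw [proxObjective_eq hγ hβ hlam hk0, proxObjective_eq hγ hβ hlam (fun s a => (hpos s a).le)] at h1
  have h2 : ∑ s, ∑ a, expStep β Δ lam s a ≤
      ∑ s, ∑ a, (k s a - k s a * Real.log (k s a / expStep β Δ lam s a)) := by
    have h3 := le_of_mul_le_mul_left (sub_le_sub_iff_right _ |>.1 h1) (inv_pos.2 hβ)
    refine le_trans (le_of_eq ?_) h3
    refine Finset.sum_congr rfl fun s _ => Finset.sum_congr rfl fun a _ => ?_
    rw [div_self (hpos s a).ne']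
    simp
  have hle : ∀ s a, k s a - k s a * Real.log (k s a / expStep β Δ lam s a) ≤
      expStep β Δ lam s a := fun s a => by
    have := sub_le_mul_log_div (hk0 s a) (hpos s a)
    linarith
  have heq : ∀ s a, k s a = expStep β Δ lam s a := by
    have h4 := (Finset.sum_eq_sum_iff_of_le (s := Finset.univ)
      fun s _ => Finset.sum_le_sum fun a _ => hle s a).1
      (le_antisymm (Finset.sum_le_sum fun s _ => Finset.sum_le_sum fun a _ => hle s a) h2)
    intro s a
    have h5 := (Finset.sum_eq_sum_iff_of_le (s := Finset.univ)
      fun a _ => hle s a).1 (h4 s (Finset.mem_univ _)) a (Finset.mem_univ _)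
    exact eq_of_mul_log_div_eq_sub (hk0 s a) (hpos s a) (by linarith)
  rw [hlam', norm1_of_nonneg hk0]
  simp only [heq, expStep, Real.exp_sub, ← mul_div_assoc, ← Finset.sum_div]
  have hZ : 0 < ∑ s, ∑ a, lam s a * Real.exp (β * Δ s a) :=
    Finset.sum_pos (fun s _ => Finset.sum_pos (fun a _ => mul_pos (hlam s a) (Real.exp_pos _))
      Finset.univ_nonempty) Finset.univ_nonempty
  have hg : (1 - γ) ≠ 0 := by linarith
  field_simp

lemma IsDualStep.pos [Nonempty S] [Nonempty A] {γ β : ℝ} (hγ : γ < 1) (hβ : 0 < β)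
    {Δ lam lam' : S → A → ℝ} (hlam : ∀ s a, 0 < lam s a) (h : IsDualStep γ β Δ lam lam') (s : S)
    (a : A) : 0 < lam' s a := by
  rw [h.eq hγ hβ hlam]
  have hZ : 0 < ∑ s, ∑ a, lam s a * Real.exp (β * Δ s a) :=
    Finset.sum_pos (fun s _ => Finset.sum_pos (fun a _ => mul_pos (hlam s a) (Real.exp_pos _))
      Finset.univ_nonempty) Finset.univ_nonempty
  exact div_pos (mul_pos (hlam s a) (Real.exp_pos _)) (mul_pos (by linarith) hZ)

lemma IsDualStep.mem_dualSet [Nonempty S] [Nonempty A] {γ β : ℝ} (hγ : γ < 1) (hβ : 0 < β)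
    {Δ lam lam' : S → A → ℝ} (hlam : ∀ s a, 0 < lam s a) (h : IsDualStep γ β Δ lam lam') :
    lam' ∈ dualSet S A γ := by
  have hp := h.pos hγ hβ hlam
  refine ⟨fun s a => (hp s a).le, ?_⟩
  rw [norm1_of_nonneg fun s a => (hp s a).le]
  simp only [h.eq hγ hβ hlam, ← Finset.sum_div]
  have hZ : 0 < ∑ s, ∑ a, lam s a * Real.exp (β * Δ s a) :=
    Finset.sum_pos (fun s _ => Finset.sum_pos (fun a _ => mul_pos (hlam s a) (Real.exp_pos _))
      Finset.univ_nonempty) Finset.univ_nonempty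
  have hg : (1 - γ) ≠ 0 := by linarith
  field_simp

/-- Invert the quadratic lower bound for exp(-x) and use (1 - x + x²/2)(1 + x + x²/2) = 1 + x⁴/4 ≥
1. No lower bound on x is needed, which is the purpose of the shifts in the algorithm. -/
lemma exp_le_quadratic_of_nonpos {x : ℝ} (hx : x ≤ 0) : Real.exp x ≤ 1 + x + x ^ 2 / 2 := by
  have h := Real.quadratic_le_exp_of_nonneg (neg_nonneg.2 hx)
  have h1 : 0 < 1 + -x + (-x) ^ 2 / 2 := by nlinarith [sq_nonneg x]
  have h2 : Real.exp x = (Real.exp (-x))⁻¹ := by rw [Real.exp_neg, inv_inv]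
  rw [h2]
  refine (inv_anti₀ h1 h).trans ?_
  rw [inv_le_iff_one_le_mul₀ h1]
  nlinarith [sq_nonneg (x ^ 2)]

/-- One step of exponential weights with losses of a constant sign. -/
lemma IsDualStep.regret [Nonempty S] [Nonempty A] {γ β : ℝ} (hγ : γ < 1) (hβ : 0 < β)
    {Δ lam lam' p : S → A → ℝ} (hlam : ∀ s a, 0 < lam s a) (hmem : lam ∈ dualSet S A γ)
    (h : IsDualStep γ β Δ lam lam') (hΔ : ∀ s a, Δ s a ≤ 0) (hp : p ∈ dualSet S A γ) :
    β * ip Δ (p - lam) ≤ ∑ s, ∑ a, p s a * Real.log (lam' s a)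
      - ∑ s, ∑ a, p s a * Real.log (lam s a)
      + β ^ 2 / 2 * ∑ s, ∑ a, lam s a * Δ s a ^ 2 := by
  have hg : 0 < 1 - γ := by linarith
  set Z := ∑ s, ∑ a, lam s a * Real.exp (β * Δ s a) with hZdef
  have hZ : 0 < Z :=
    Finset.sum_pos (fun s _ => Finset.sum_pos (fun a _ => mul_pos (hlam s a) (Real.exp_pos _))
      Finset.univ_nonempty) Finset.univ_nonempty
  have hlog : ∀ s a, Real.log (lam' s a) =
      Real.log (lam s a) + β * Δ s a - Real.log ((1 - γ) * Z) := fun s a => by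
    rw [h.eq hγ hβ hlam, Real.log_div (mul_pos (hlam s a) (Real.exp_pos _)).ne'
      (mul_pos hg hZ).ne', Real.log_mul (hlam s a).ne' (Real.exp_pos _).ne', Real.log_exp]
  have hsum : ∑ s, ∑ a, p s a * Real.log (lam' s a) =
      ∑ s, ∑ a, p s a * Real.log (lam s a) + β * ip Δ p
        - (1 - γ)⁻¹ * Real.log ((1 - γ) * Z) := by
    rw [← sum_of_mem_dualSet hp]
    simp only [ip, Finset.mul_sum, Finset.sum_mul, ← Finset.sum_add_distrib,
      ← Finset.sum_sub_distrib]
    refine Finset.sum_congr rfl fun s _ => Finset.sum_congr rfl fun a _ => ?_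
    rw [hlog]
    ring
  have hZle : Z ≤ (1 - γ)⁻¹ + β * ip Δ lam + β ^ 2 / 2 * ∑ s, ∑ a, lam s a * Δ s a ^ 2 := by
    rw [← sum_of_mem_dualSet hmem]
    simp only [hZdef, ip, Finset.mul_sum, ← Finset.sum_add_distrib]
    refine Finset.sum_le_sum fun s _ => Finset.sum_le_sum fun a _ => ?_
    have := mul_le_mul_of_nonneg_left
      (exp_le_quadratic_of_nonpos (mul_nonpos_of_nonneg_of_nonpos hβ.le (hΔ s a))) (hlam s a).le
    linarith
  have hlogZ : (1 - γ)⁻¹ * Real.log ((1 - γ) * Z) ≤ Z - (1 - γ)⁻¹ := by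
    have := mul_le_mul_of_nonneg_left (Real.log_le_sub_one_of_pos (mul_pos hg hZ))
      (inv_pos.2 hg).le
    rwa [mul_sub, inv_mul_cancel_left₀ hg.ne', mul_one] at this
  rw [ip_sub_right, hsum]
  linarith

/-! ### The projection step -/

lemma IsProj.sum_sq_le {V : Set (S → ℝ)} (hV : Convex ℝ V) {y w z : S → ℝ} (h : IsProj V y w)
    (hz : z ∈ V) : ∑ s, (w s - z s) ^ 2 ≤ ∑ s, (y s - z s) ^ 2 := by
  have hvar : 0 ≤ ∑ s, (w s - y s) * (z s - w s) := by
    by_contra! hneg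
    set a := ∑ s, (w s - y s) * (z s - w s)
    set b := ∑ s, (z s - w s) ^ 2
    have hb : 0 ≤ b := Finset.sum_nonneg fun _ _ => sq_nonneg _
    have hq : ∀ θ : ℝ, 0 ≤ θ → θ ≤ 1 → 0 ≤ 2 * θ * a + θ ^ 2 * b := by
      intro θ h0 h1
      have h2 := h.2 _ (hV h.1 hz (sub_nonneg.2 h1) h0 (by ring))
      have h3 : ∑ s, ((((1 - θ) • w + θ • z) s - y s) ^ 2) =
          ∑ s, (w s - y s) ^ 2 + (2 * θ * a + θ ^ 2 * b) := by
        simp only [a, b, Finset.mul_sum, ← Finset.sum_add_distrib]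
        refine Finset.sum_congr rfl fun s _ => ?_
        simp only [Pi.add_apply, Pi.smul_apply, smul_eq_mul]
        ring
      linarith
    -- The minimizer -a/b of the quadratic may exceed 1, or b may vanish. The denominator b - a
    -- keeps θ in [0, 1] and still makes the value negative.
    have h4 := hq (-a / (b - a)) (div_nonneg (by linarith) (by linarith))
      ((div_le_one (by linarith)).2 (by linarith))
    have h5 : 2 * (-a / (b - a)) * a + (-a / (b - a)) ^ 2 * b =
        a ^ 2 * (2 * a - b) / (b - a) ^ 2 := by
      have : b - a ≠ 0 := by linarith
      field_simp
      ring
    rw [h5] at h4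
    have h6 : a ^ 2 * (2 * a - b) / (b - a) ^ 2 < 0 := by
      apply div_neg_of_neg_of_pos
      · exact mul_neg_of_pos_of_neg (by nlinarith) (by linarith)
      · have : 0 < b - a := by linarith
        positivity
    linarith
  have hexp : ∑ s, (y s - z s) ^ 2 = ∑ s, (w s - z s) ^ 2 + ∑ s, (w s - y s) ^ 2
      + 2 * ∑ s, (w s - y s) * (z s - w s) := by
    simp only [Finset.mul_sum, ← Finset.sum_add_distrib]
    refine Finset.sum_congr rfl fun s _ => ?_
    ring
  have : 0 ≤ ∑ s, (w s - y s) ^ 2 := Finset.sum_nonneg fun _ _ => sq_nonneg _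
  linarith

/-- One step of projected gradient descent. -/
lemma IsProj.regret {V : Set (S → ℝ)} (hV : Convex ℝ V) {v v' z G : S → ℝ} {α : ℝ}
    (h : IsProj V (fun x => v x - α * G x) v') (hz : z ∈ V) :
    2 * α * ∑ s, (v s - z s) * G s ≤ ∑ s, (v s - z s) ^ 2 - ∑ s, (v' s - z s) ^ 2
      + α ^ 2 * ∑ s, G s ^ 2 := by
  have h1 := h.sum_sq_le hV hz
  have h2 : ∑ s, (v s - α * G s - z s) ^ 2 = ∑ s, (v s - z s) ^ 2
      - 2 * α * ∑ s, (v s - z s) * G s + α ^ 2 * ∑ s, G s ^ 2 := by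
    simp only [Finset.mul_sum, ← Finset.sum_add_distrib, ← Finset.sum_sub_distrib]
    refine Finset.sum_congr rfl fun s _ => ?_
    ring
  linarith

end Deterministic

/-! ### Feasibility repair and Lipschitz bounds. -/

section Penalty

lemma MDP.integrable_reward {S A : Type*} [Fintype S] (M : MDP S A) (i j : S) (a : A) :
    Integrable (fun x : ℝ => x) (M.rewardLaw i j a) := by
  have := M.rewardLaw_prob i j a
  refine Integrable.of_bound measurable_id.aestronglyMeasurable 1 ?_
  filter_upwards [M.rewardLaw_mem i j a] with x hx
  rw [Real.norm_eq_abs, abs_of_nonneg hx.1]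
  exact hx.2

variable {S A : Type*} [Fintype S] [Fintype A]

/-! ### The exact penalty bound -/

/-- The transpose of a row-stochastic matrix does not increase the ℓ¹ norm. -/
lemma sum_abs_le_of_discounted {Q : S → S → ℝ} (hQ : ∀ i j, 0 ≤ Q i j) (hQ1 : ∀ i, ∑ j, Q i j = 1)
    {γ : ℝ} (hγ : 0 ≤ γ) {d b : S → ℝ} (h : ∀ s, d s = b s + γ * ∑ i, Q i s * d i) :
    (1 - γ) * ∑ s, |d s| ≤ ∑ s, |b s| := by
  have h1 : ∑ s, |d s| ≤ ∑ s, (|b s| + γ * ∑ i, Q i s * |d i|) := by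
    refine Finset.sum_le_sum fun s _ => ?_
    conv_lhs => rw [h s]
    refine (abs_add_le _ _).trans ?_
    rw [abs_mul, abs_of_nonneg hγ]
    gcongr
    refine (Finset.abs_sum_le_sum_abs _ _).trans (le_of_eq ?_)
    simp only [abs_mul, abs_of_nonneg (hQ _ _)]
  have h2 : ∑ s, (|b s| + γ * ∑ i, Q i s * |d i|) = ∑ s, |b s| + γ * ∑ i, |d i| := by
    rw [Finset.sum_add_distrib, ← Finset.mul_sum, Finset.sum_comm]
    simp only [← Finset.sum_mul, hQ1, one_mul]
  linarith

/-- The ℓ¹ bound with zero source makes I - γQᵀ injective, hence surjective in finite dimension. -/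
lemma exists_discounted_fixedPoint {Q : S → S → ℝ} (hQ : ∀ i j, 0 ≤ Q i j)
    (hQ1 : ∀ i, ∑ j, Q i j = 1) {γ : ℝ} (hγ : 0 ≤ γ) (hγ1 : γ < 1) (b : S → ℝ) :
    ∃ x : S → ℝ, ∀ s, x s = b s + γ * ∑ i, Q i s * x i := by
  let f : (S → ℝ) →ₗ[ℝ] (S → ℝ) :=
    { toFun := fun x s => x s - γ * ∑ i, Q i s * x i
      map_add' := fun x y => by
        funext s
        simp only [Pi.add_apply, mul_add, Finset.sum_add_distrib]
        ring
      map_smul' := fun r x => by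
        funext s
        simp only [Pi.smul_apply, smul_eq_mul, RingHom.id_apply, Finset.mul_sum, mul_sub]
        congr 1
        refine Finset.sum_congr rfl fun i _ => ?_
        ring }
  have hinj : Function.Injective f := by
    rw [← LinearMap.ker_eq_bot, LinearMap.ker_eq_bot']
    intro x hx
    have h1 : ∀ s, x s = 0 + γ * ∑ i, Q i s * x i := fun s => by
      have : x s - γ * ∑ i, Q i s * x i = 0 := congrFun hx s
      linarith
    have h2 := sum_abs_le_of_discounted (b := fun _ => 0) hQ hQ1 hγ h1
    simp only [abs_zero, Finset.sum_const_zero] at h2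
    have h3 : ∑ s, |x s| = 0 := by
      have h4 : 0 ≤ ∑ s, |x s| := Finset.sum_nonneg fun _ _ => abs_nonneg _
      nlinarith
    funext s
    exact abs_eq_zero.1
      ((Finset.sum_eq_zero_iff_of_nonneg fun _ _ => abs_nonneg _).1 h3 s (Finset.mem_univ _))
  obtain ⟨x, hx⟩ := (LinearMap.injective_iff_surjective.1 hinj) b
  refine ⟨x, fun s => ?_⟩
  have : x s - γ * ∑ i, Q i s * x i = b s := congrFun hx s
  linarith

lemma sum_xi [Nonempty S] : ∑ s, xi S s = 1 := by
  simp [xi]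

lemma xi_nonneg (s : S) : 0 ≤ xi S s := by
  unfold xi
  positivity

/-- Summing the equation gives the total mass, and the ℓ¹ bound then gives ∑|x| ≤ ∑x, which forces x
= |x|. No Neumann series is needed. -/
lemma discounted_nonneg {Q : S → S → ℝ} (hQ : ∀ i j, 0 ≤ Q i j) (hQ1 : ∀ i, ∑ j, Q i j = 1)
    {γ : ℝ} (hγ : 0 ≤ γ) (hγ1 : γ < 1) {b x : S → ℝ} (hb : ∀ s, 0 ≤ b s)
    (h : ∀ s, x s = b s + γ * ∑ i, Q i s * x i) :
    (∀ s, 0 ≤ x s) ∧ ∑ s, x s = (1 - γ)⁻¹ * ∑ s, b s := by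
  have hg : 0 < 1 - γ := by linarith
  have h1 : ∑ s, x s = ∑ s, b s + γ * ∑ s, x s := by
    conv_lhs => rw [Finset.sum_congr rfl fun s _ => h s]
    rw [Finset.sum_add_distrib, ← Finset.mul_sum, Finset.sum_comm]
    simp only [← Finset.sum_mul, hQ1, one_mul]
  have h2 : ∑ s, x s = (1 - γ)⁻¹ * ∑ s, b s := by
    field_simp
    linarith
  refine ⟨?_, h2⟩
  have h3 := sum_abs_le_of_discounted hQ hQ1 hγ h
  simp only [abs_of_nonneg (hb _)] at h3
  have h4 : ∑ s, (|x s| - x s) = 0 := by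
    refine le_antisymm ?_ (Finset.sum_nonneg fun s _ => sub_nonneg.2 (le_abs_self _))
    rw [Finset.sum_sub_distrib]
    nlinarith
  intro s
  have h5 := (Finset.sum_eq_zero_iff_of_nonneg fun s _ => sub_nonneg.2 (le_abs_self (x s))).1 h4 s
    (Finset.mem_univ _)
  rw [← sub_eq_zero.1 h5]
  exact abs_nonneg _

/-- Every occupancy array is its state marginal times a stationary policy. -/
lemma exists_policy [Nonempty A] {lam : S → A → ℝ} (h : ∀ s a, 0 ≤ lam s a) :
    ∃ π : S → A → ℝ, (∀ s a, 0 ≤ π s a) ∧ (∀ s, ∑ a, π s a = 1) ∧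
      ∀ s a, lam s a = (∑ b, lam s b) * π s a := by
  classical
  -- At states of zero mass any distribution works; the uniform one is used.
  refine ⟨fun s a => if ∑ b, lam s b = 0 then 1 / Fintype.card A else lam s a / ∑ b, lam s b,
    fun s a => ?_, fun s => ?_, fun s a => ?_⟩
  · dsimp only
    split_ifs
    · positivity
    · exact div_nonneg (h s a) (Finset.sum_nonneg fun b _ => h s b)
  · dsimp only
    split_ifs with h0
    · simp
    · rw [← Finset.sum_div, div_self h0]
  · dsimp only
    split_ifs with h0
    · rw [h0, zero_mul]
      exact (Finset.sum_eq_zero_iff_of_nonneg fun b _ => h s b).1 h0 a (Finset.mem_univ _)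
    · field_simp

lemma MDP.flowResidual_mul (M : MDP S A) (x : S → ℝ) {π : S → A → ℝ}
    (hπ : ∀ s, ∑ a, π s a = 1) (s : S) :
    M.flowResidual (fun i a => x i * π i a) s =
      x s - M.γ * ∑ i, (∑ a, π i a * M.P a i s) * x i - xi S s := by
  simp only [MDP.flowResidual, Finset.sum_sub_distrib, ← Finset.mul_sum, hπ, mul_one]
  rw [Finset.sum_comm]
  congr 3
  refine Finset.sum_congr rfl fun i _ => ?_
  rw [Finset.sum_mul]
  exact Finset.sum_congr rfl fun a _ => by ring

/-- Every element of the dual set is close to a feasible array. -/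
lemma MDP.exists_feasible_close [Nonempty S] [Nonempty A] (M : MDP S A) {lam : S → A → ℝ}
    (hlam : lam ∈ dualSet S A M.γ) :
    ∃ k ∈ M.feasible, (1 - M.γ) * norm1 (lam - k) ≤ M.violation lam := by
  obtain ⟨π, hπ0, hπ1, hlamπ⟩ := exists_policy hlam.1
  set m : S → ℝ := fun s => ∑ b, lam s b
  have hlam' : lam = fun i a => m i * π i a := by
    funext i a
    exact hlamπ i a
  set Q : S → S → ℝ := fun i s => ∑ a, π i a * M.P a i s with hQdef
  have hQ : ∀ i j, 0 ≤ Q i j := fun i j =>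
    Finset.sum_nonneg fun a _ => mul_nonneg (hπ0 i a) (M.P_nonneg a i j)
  have hQ1 : ∀ i, ∑ j, Q i j = 1 := fun i => by
    simp only [hQdef]
    rw [Finset.sum_comm]
    simp only [← Finset.mul_sum, M.P_sum, mul_one, hπ1]
  -- The policy π of `lam` is kept and only its state marginal is replaced: x is the discounted
  -- occupancy from ξ under π.
  obtain ⟨x, hx⟩ := exists_discounted_fixedPoint hQ hQ1 M.γ_pos.le M.γ_lt_one (xi S)
  obtain ⟨hx0, hxs⟩ := discounted_nonneg hQ hQ1 M.γ_pos.le M.γ_lt_one xi_nonneg hx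
  have hk0 : ∀ i a, 0 ≤ x i * π i a := fun i a => mul_nonneg (hx0 i) (hπ0 i a)
  refine ⟨fun i a => x i * π i a, ⟨⟨hk0, ?_⟩, fun s => ?_⟩, ?_⟩
  · rw [norm1_of_nonneg hk0]
    simp only [← Finset.mul_sum, hπ1, mul_one, hxs, sum_xi]
  · rw [M.flowResidual_mul x hπ1]
    have := hx s
    linarith
  -- The difference of the marginals solves the same discounted equation with the flow residual as
  -- source.
  · have hd : ∀ s, (m s - x s) = M.flowResidual lam s + M.γ * ∑ i, Q i s * (m i - x i) := fun s => by
      have h1 : M.flowResidual lam s = m s - M.γ * ∑ i, Q i s * m i - xi S s := by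
        conv_lhs => rw [hlam']
        exact M.flowResidual_mul m hπ1 s
      have h2 := hx s
      simp only [mul_sub, Finset.sum_sub_distrib]
      rw [h1]
      linarith
    have h3 := sum_abs_le_of_discounted hQ hQ1 M.γ_pos.le hd
    refine le_trans (le_of_eq ?_) h3
    congr 1
    unfold norm1
    refine Finset.sum_congr rfl fun s _ => ?_
    have : ∀ a, |(lam - fun i a => x i * π i a) s a| = |m s - x s| * π s a := fun a => by
      rw [Pi.sub_apply, Pi.sub_apply, hlamπ s a, ← sub_mul, abs_mul, abs_of_nonneg (hπ0 s a)]
    simp only [this, ← Finset.mul_sum, hπ1, mul_one]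

lemma dualSet_nonempty [Nonempty S] [Nonempty A] {γ : ℝ} (hγ : γ < 1) :
    (fun (_ : S) (_ : A) => 1 / (numSA S A * (1 - γ))) ∈ dualSet S A γ := by
  have hg : 0 < 1 - γ := by linarith
  have hn : 0 < numSA S A := by unfold numSA; positivity
  have h0 : ∀ (s : S) (a : A), 0 ≤ (fun (_ : S) (_ : A) => 1 / (numSA S A * (1 - γ))) s a :=
    fun s a => by positivity
  refine ⟨h0, ?_⟩
  rw [norm1_of_nonneg h0]
  simp only [Finset.sum_const, Finset.card_univ, nsmul_eq_mul, numSA]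
  field_simp

lemma MDP.feasible_nonempty [Nonempty S] [Nonempty A] (M : MDP S A) : M.feasible.Nonempty := by
  obtain ⟨k, hk, -⟩ := M.exists_feasible_close (dualSet_nonempty M.γ_lt_one)
  exact ⟨k, hk⟩

/-! ### The caution function and the rewards -/

section Caution

variable {γ σ : ℝ} {D : Set (S → A → ℝ)} {ρ : (S → A → ℝ) → ℝ}

lemma IsCaution.nonneg [Nonempty S] [Nonempty A] (h : IsCaution γ D ρ σ) (hγ : γ < 1) :
    0 ≤ σ := by
  obtain ⟨u, hu⟩ := h.nonempty _ (dualSet_nonempty hγ)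
  exact (abs_nonneg _).trans
    (h.bound _ (dualSet_nonempty hγ) u hu (Classical.arbitrary S) (Classical.arbitrary A))

lemma IsCaution.sub_le (h : IsCaution γ D ρ σ) {x y : S → A → ℝ} (hx : x ∈ dualSet S A γ)
    (hy : y ∈ dualSet S A γ) : ρ x - ρ y ≤ σ * norm1 (x - y) := by
  obtain ⟨u, hu⟩ := h.nonempty _ hx
  have h1 := hu y (h.dom hy)
  have h2 := (abs_le.1 (abs_ip_le (y := y - x) (h.bound _ hx u hu))).1
  rw [norm1_sub_comm]
  linarith

lemma IsCaution.abs_sub_le (h : IsCaution γ D ρ σ) {x y : S → A → ℝ} (hx : x ∈ dualSet S A γ)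
    (hy : y ∈ dualSet S A γ) : |ρ x - ρ y| ≤ σ * norm1 (x - y) := by
  rw [abs_sub_le_iff]
  refine ⟨h.sub_le hx hy, ?_⟩
  rw [norm1_sub_comm]
  exact h.sub_le hy hx

/-- Supplies the measurability of `ρ` at the random output. -/
lemma IsCaution.continuousOn (h : IsCaution γ D ρ σ) : ContinuousOn ρ (dualSet S A γ) := by
  intro x hx
  rw [ContinuousWithinAt, tendsto_iff_dist_tendsto_zero]
  have hlim : Filter.Tendsto (fun y => σ * norm1 (y - x)) (nhdsWithin x (dualSet S A γ))
      (nhds 0) := by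
    have hc : Continuous fun y : S → A → ℝ => σ * norm1 (y - x) := by
      unfold norm1
      simp only [Pi.sub_apply]
      fun_prop
    have := (hc.tendsto x).mono_left (nhdsWithin_le_nhds (s := dualSet S A γ))
    simpa [norm1] using this
  refine squeeze_zero' (Filter.Eventually.of_forall fun _ => dist_nonneg) ?_ hlim
  filter_upwards [self_mem_nhdsWithin] with y hy
  rw [Real.dist_eq]
  exact h.abs_sub_le hy hx

end Caution

lemma MDP.r_mem (M : MDP S A) (i : S) (a : A) : M.r i a ∈ Set.Icc (0 : ℝ) 1 := by
  have h : ∀ j, (∫ x, x ∂(M.rewardLaw i j a)) ∈ Set.Icc (0 : ℝ) 1 := fun j => by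
    have := M.rewardLaw_prob i j a
    refine ⟨integral_nonneg_of_ae ?_, ?_⟩
    · filter_upwards [M.rewardLaw_mem i j a] with x hx using hx.1
    · calc (∫ x, x ∂(M.rewardLaw i j a)) ≤ ∫ _, (1 : ℝ) ∂(M.rewardLaw i j a) := by
            refine integral_mono_ae (M.integrable_reward i j a) (integrable_const _) ?_
            filter_upwards [M.rewardLaw_mem i j a] with x hx using hx.2
        _ = 1 := by simp
  refine ⟨Finset.sum_nonneg fun j _ => mul_nonneg (M.P_nonneg a i j) (h j).1, ?_⟩
  calc M.r i a ≤ ∑ j, M.P a i j :=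
        Finset.sum_le_sum fun j _ => mul_le_of_le_one_right (M.P_nonneg a i j) (h j).2
    _ = 1 := M.P_sum a i

lemma MDP.abs_r_le (M : MDP S A) (i : S) (a : A) : |M.r i a| ≤ 1 := by
  rw [abs_of_nonneg (M.r_mem i a).1]
  exact (M.r_mem i a).2

lemma MDP.objective_sub_le (M : MDP S A) {c σ : ℝ} (hc : 0 ≤ c) {D : Set (S → A → ℝ)}
    {ρ : (S → A → ℝ) → ℝ} (hρ : IsCaution M.γ D ρ σ) {x y : S → A → ℝ}
    (hx : x ∈ dualSet S A M.γ) (hy : y ∈ dualSet S A M.γ) :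
    M.objective c ρ x - M.objective c ρ y ≤ (1 + c * σ) * norm1 (x - y) := by
  have h1 := (abs_le.1 (abs_ip_le (y := x - y) M.abs_r_le)).2
  have h2 := hρ.sub_le hy hx
  rw [norm1_sub_comm] at h2
  rw [ip_sub_right] at h1
  have h3 := mul_le_mul_of_nonneg_left h2 hc
  rw [MDP.objective, MDP.objective, ip_comm x, ip_comm y]
  linarith

/-- Feasibility violations are an exact penalty for the cautious problem. -/
lemma MDP.exists_feasible_objective_ge [Nonempty S] [Nonempty A] (M : MDP S A) {c σ : ℝ}
    (hc : 0 ≤ c) {D : Set (S → A → ℝ)} {ρ : (S → A → ℝ) → ℝ} (hρ : IsCaution M.γ D ρ σ)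
    {lam : S → A → ℝ} (hlam : lam ∈ dualSet S A M.γ) :
    ∃ k ∈ M.feasible, M.objective c ρ lam ≤
      M.objective c ρ k + (1 + c * σ) / (1 - M.γ) * M.violation lam := by
  obtain ⟨k, hk, hclose⟩ := M.exists_feasible_close hlam
  refine ⟨k, hk, ?_⟩
  have hg : 0 < 1 - M.γ := by linarith [M.γ_lt_one]
  have hσ := hρ.nonneg M.γ_lt_one
  have h1 := M.objective_sub_le hc hρ hlam hk.1
  have h2 : norm1 (lam - k) ≤ M.violation lam / (1 - M.γ) := by
    rw [le_div_iff₀ hg]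
    linarith
  have h3 := mul_le_mul_of_nonneg_left h2 (by positivity : 0 ≤ 1 + c * σ)
  have h4 : (1 + c * σ) / (1 - M.γ) * M.violation lam =
    (1 + c * σ) * (M.violation lam / (1 - M.γ)) := by ring
  linarith

lemma convex_dualSet (γ : ℝ) : Convex ℝ (dualSet S A γ) := by
  intro x hx y hy p q hp hq hpq
  have h0 : ∀ s a, 0 ≤ (p • x + q • y) s a := fun s a => by
    have := hx.1 s a
    have := hy.1 s a
    simp only [Pi.add_apply, Pi.smul_apply, smul_eq_mul]
    positivity
  refine ⟨h0, ?_⟩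
  rw [norm1_of_nonneg h0]
  simp only [Pi.add_apply, Pi.smul_apply, smul_eq_mul, Finset.sum_add_distrib, ← Finset.mul_sum,
    sum_of_mem_dualSet hx, sum_of_mem_dualSet hy]
  rw [← add_mul, hpq, one_mul]

lemma norm1_sub_le {γ : ℝ} {x y : S → A → ℝ} (hx : x ∈ dualSet S A γ)
    (hy : y ∈ dualSet S A γ) : norm1 (x - y) ≤ 2 * (1 - γ)⁻¹ := by
  rw [two_mul]
  nth_rewrite 1 [← hx.2]
  rw [← hy.2]
  simp only [norm1, ← Finset.sum_add_distrib]
  exact Finset.sum_le_sum fun s _ => Finset.sum_le_sum fun a _ => abs_sub _ _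

end Penalty

/-! ### Positivity of the step sizes. -/

section StepSizes

variable {S A : Type*} [Fintype S] [Fintype A] {c σ : ℝ} {T : ℕ}

lemma stepβ_pos {γ : ℝ} (hγ : γ < 1) (hcσ : 0 ≤ c * σ) (hn : 1 < numSA S A) (hT : 0 < T) :
    0 < stepβ S A γ c σ T := by
  have hl := Real.log_pos hn
  have hT' : (0 : ℝ) < T := by exact_mod_cast hT
  have hg : 0 < 1 - γ := by linarith
  unfold stepβ
  have : 0 < Real.log (numSA S A) / (T * numSA S A) := by positivity
  have := Real.sqrt_pos.2 this
  positivity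

lemma stepα_pos [Nonempty S] (hcσ : 0 ≤ c * σ) (hT : 0 < T) : 0 < stepα S c σ T := by
  have hT' : (0 : ℝ) < T := by exact_mod_cast hT
  unfold stepα
  have : 0 < (Fintype.card S : ℝ) / T := by positivity
  have := Real.sqrt_pos.2 this
  positivity

end StepSizes

/-! ### Domains of the iterates and the law of one iteration. -/

section Sampling

variable {S A : Type*} [Fintype S] [Fintype A] [DecidableEq S] [DecidableEq A]
  {M : MDP S A} {c σ δ : ℝ} {D : Set (S → A → ℝ)} {ρ : (S → A → ℝ) → ℝ} {T : ℕ}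
  {Ω : Type*} [mΩ : MeasurableSpace Ω] {μ : Measure Ω}

/-! ### The iterates stay in their domains -/

namespace Run

lemma v_mem (R : Run M c σ δ D ρ T μ) {t : ℕ} (ht : t ≤ T) (ω : Ω) :
    R.v t ω ∈ primalSet S M.γ c σ := by
  cases t with
  | zero => exact R.v_init ω
  | succ t => exact (R.v_step t ht ω).1

section Iterates

variable [Nonempty S] [Nonempty A]

/-- The multiplicative update preserves strict positivity, so its closed form applies at every
iteration. -/
lemma lam_pos (R : Run M c σ δ D ρ T μ) (hcσ : 0 ≤ c * σ) (hn : 1 < numSA S A) {t : ℕ}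
    (ht : t ≤ T) (ω : Ω) (s : S) (a : A) : 0 < R.lam t ω s a := by
  have hg : 0 < 1 - M.γ := by linarith [M.γ_lt_one]
  induction t generalizing s a with
  | zero =>
    rw [R.lam_init]
    positivity
  | succ t ih =>
    exact (R.lam_step t ht ω).pos M.γ_lt_one (stepβ_pos M.γ_lt_one hcσ hn (by omega))
      (ih (by omega)) s a

lemma lam_mem (R : Run M c σ δ D ρ T μ) (hcσ : 0 ≤ c * σ) (hn : 1 < numSA S A) {t : ℕ}
    (ht : t ≤ T) (ω : Ω) : R.lam t ω ∈ dualSet S A M.γ := by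
  cases t with
  | zero =>
    have : R.lam 0 ω = fun _ _ => 1 / (numSA S A * (1 - M.γ)) := by
      funext s a
      exact R.lam_init ω s a
    rw [this]
    exact dualSet_nonempty M.γ_lt_one
  | succ t =>
    exact (R.lam_step t ht ω).mem_dualSet M.γ_lt_one (stepβ_pos M.γ_lt_one hcσ hn (by omega))
      (R.lam_pos hcσ hn (by omega) ω)

lemma avg_mem (R : Run M c σ δ D ρ T μ) (hcσ : 0 ≤ c * σ) (hn : 1 < numSA S A) (hT : 0 < T)
    (ω : Ω) : R.avg ω ∈ dualSet S A M.γ := by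
  have hT' : (0 : ℝ) < T := by exact_mod_cast hT
  have h := (convex_dualSet (S := S) (A := A) M.γ).sum_mem (t := Finset.range T)
    (w := fun _ => 1 / (T : ℝ)) (z := fun t => R.lam t ω) (fun _ _ => by positivity)
    (by simp [hT'.ne']) (fun t ht => R.lam_mem hcσ hn (Finset.mem_range.1 ht).le ω)
  convert h using 1
  funext s a
  simp [Run.avg, Finset.sum_apply, Finset.mul_sum]

end Iterates

/-! ### Expectations over a sample -/

lemma measurable_lam (R : Run M c σ δ D ρ T μ) {t : ℕ} (ht : t ≤ T) (s : S) (a : A) :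
    Measurable[R.ℱ t] fun ω => R.lam t ω s a :=
  (measurable_pi_apply a).comp ((measurable_pi_apply s).comp (R.lam_adapted t ht))

lemma measurable_v (R : Run M c σ δ D ρ T μ) {t : ℕ} (ht : t ≤ T) (s : S) :
    Measurable[R.ℱ t] fun ω => R.v t ω s :=
  (measurable_pi_apply s).comp (R.v_adapted t ht)

lemma measurable_zeta (R : Run M c σ δ D ρ T μ) {t : ℕ} (ht : t ≤ T) (s : S) (a : A) :
    Measurable[R.ℱ t] fun ω => zeta M.γ δ (R.lam t ω) s a :=
  ((R.measurable_lam ht s a).const_mul _).add_const _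

/-- The event that iteration `t` samples `(s, a, s', s₀)`. -/
def sampleEvent (R : Run M c σ δ D ρ T μ) (t : ℕ) (i : S × A × S × S) : Set Ω :=
  {ω | R.st t ω = i.1 ∧ R.act t ω = i.2.1 ∧ R.nxt t ω = i.2.2.1 ∧ R.sbar t ω = i.2.2.2}

/-- The sample of iteration `t`. -/
def sample (R : Run M c σ δ D ρ T μ) (t : ℕ) (ω : Ω) : S × A × S × S :=
  (R.st t ω, R.act t ω, R.nxt t ω, R.sbar t ω)

lemma mem_sampleEvent (R : Run M c σ δ D ρ T μ) (t : ℕ) (i : S × A × S × S) (ω : Ω) :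
    ω ∈ R.sampleEvent t i ↔ R.sample t ω = i := by
  simp only [sampleEvent, sample, Set.mem_ofPred_eq, Prod.ext_iff]

lemma measurableSet_sampleEvent (R : Run M c σ δ D ρ T μ) {t : ℕ} (ht : t < T)
    (i : S × A × S × S) : MeasurableSet[R.ℱ (t + 1)] (R.sampleEvent t i) :=
  (R.st_meas t ht _).inter ((R.act_meas t ht _).inter ((R.nxt_meas t ht _).inter
    (R.sbar_meas t ht _)))

/-- The conditional probability of the sample `i = (s, a, s', s₀)` at the dual iterate `lam`. -/
noncomputable def sampleProb (M : MDP S A) (δ : ℝ) (lam : S → A → ℝ) (i : S × A × S × S) : ℝ :=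
  zeta M.γ δ lam i.1 i.2.1 * M.P i.2.1 i.1 i.2.2.1 * xi S i.2.2.2

/-- The law of the reward revealed on the sample `i`. -/
noncomputable def sampleLaw (M : MDP S A) (i : S × A × S × S) : Measure ℝ :=
  M.rewardLaw i.1 i.2.2.1 i.2.1

lemma measurable_sampleProb (R : Run M c σ δ D ρ T μ) {t : ℕ} (ht : t ≤ T)
    (i : S × A × S × S) : Measurable[R.ℱ t] fun ω => sampleProb M δ (R.lam t ω) i :=
  ((R.measurable_zeta ht _ _).mul_const _).mul_const _

/-- The finite sample space carries no σ-algebra, so the composition is split into indicators of the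
measurable sample events. -/
lemma measurable_of_sample (R : Run M c σ δ D ρ T μ) {t : ℕ} (ht : t < T)
    {f : S × A × S × S → Ω → ℝ} (hf : ∀ i, Measurable[R.ℱ (t + 1)] (f i)) :
    Measurable[R.ℱ (t + 1)] fun ω => f (R.sample t ω) ω := by
  have : (fun ω => f (R.sample t ω) ω) =
      fun ω => ∑ i, (R.sampleEvent t i).indicator (f i) ω := by
    funext ω
    rw [Finset.sum_eq_single (R.sample t ω)]
    · rw [Set.indicator_of_mem ((R.mem_sampleEvent t _ ω).2 rfl)]
    · intro i _ hi
      exact Set.indicator_of_notMem (fun h => hi ((R.mem_sampleEvent t _ ω).1 h).symm) _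
    · simp
  rw [this]
  exact Finset.measurable_fun_sum _ fun i _ =>
    (hf i).indicator (R.measurableSet_sampleEvent ht i)

variable [IsProbabilityMeasure μ]

lemma real_inter_sampleEvent (R : Run M c σ δ D ρ T μ) {t : ℕ} (ht : t < T) (i : S × A × S × S)
    {H : Set Ω} (hH : MeasurableSet[R.ℱ t] H) {B : Set ℝ} (hB : MeasurableSet B) :
    μ.real (R.rew t ⁻¹' B ∩ (H ∩ R.sampleEvent t i)) =
      (∫ ω in H, sampleProb M δ (R.lam t ω) i ∂μ) * (sampleLaw M i).real B := by
  have hle := R.ℱ.le t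
  have hrew : Measurable (R.rew t) := (R.rew_meas t ht).mono (R.ℱ.le _) le_rfl
  have hE : MeasurableSet (R.sampleEvent t i) :=
    R.ℱ.le _ _ (R.measurableSet_sampleEvent ht i)
  set F : Set Ω := {ω | R.st t ω = i.1 ∧ R.act t ω = i.2.1 ∧ R.nxt t ω = i.2.2.1 ∧
    R.rew t ω ∈ B ∧ R.sbar t ω = i.2.2.2} with hF
  have hFeq : F = R.sampleEvent t i ∩ R.rew t ⁻¹' B := by
    ext ω
    simp only [hF, sampleEvent, Set.mem_ofPred_eq, Set.mem_inter_iff, Set.mem_preimage]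
    tauto
  have hFm : MeasurableSet F := by
    rw [hFeq]
    exact hE.inter (hrew hB)
  have hint : Integrable (F.indicator fun _ => (1 : ℝ)) μ := (integrable_const 1).indicator hFm
  have h1 := setIntegral_condExp hle hint hH
  have h2 := R.sample_law t ht i.1 i.2.1 i.2.2.1 i.2.2.2 B hB
  rw [setIntegral_congr_ae (hle _ hH) (h2.mono fun ω hω _ => hω)] at h1
  have h3 : ∫ ω in H, F.indicator (fun _ => (1 : ℝ)) ω ∂μ = μ.real (F ∩ H) := by
    rw [integral_indicator hFm, setIntegral_const, smul_eq_mul, mul_one,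
      measureReal_restrict_apply hFm]
  rw [h3] at h1
  rw [← integral_mul_const]
  have h4 : R.rew t ⁻¹' B ∩ (H ∩ R.sampleEvent t i) = F ∩ H := by
    rw [hFeq]
    ext ω
    simp only [Set.mem_inter_iff]
    tauto
  rw [h4, ← h1]
  refine integral_congr_ae (Filter.Eventually.of_forall fun ω => ?_)
  simp only [sampleProb, sampleLaw]
  ring

/-- Given the sample, the reward is independent of the history. Writing this as an identity of
measures allows passage from probabilities of Borel sets to integrals of functions of the reward. -/
lemma map_rew_restrict (R : Run M c σ δ D ρ T μ) {t : ℕ} (ht : t < T) (i : S × A × S × S)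
    {H : Set Ω} (hH : MeasurableSet[R.ℱ t] H) :
    (μ.restrict (H ∩ R.sampleEvent t i)).map (R.rew t) =
      ENNReal.ofReal (∫ ω in H, sampleProb M δ (R.lam t ω) i ∂μ) • sampleLaw M i := by
  have hrew : Measurable (R.rew t) := (R.rew_meas t ht).mono (R.ℱ.le _) le_rfl
  have : IsProbabilityMeasure (sampleLaw M i) := M.rewardLaw_prob _ _ _
  have h0 : 0 ≤ ∫ ω in H, sampleProb M δ (R.lam t ω) i ∂μ := by
    -- Since δ is unconstrained here, nonnegativity is read off from a probability and not from the
    -- formula for ζ.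
    have h1 := R.real_inter_sampleEvent ht i hH MeasurableSet.univ
    rw [probReal_univ, mul_one] at h1
    rw [← h1]
    exact measureReal_nonneg
  ext B hB
  rw [Measure.map_apply hrew hB, Measure.restrict_apply (hrew hB), Measure.smul_apply, smul_eq_mul,
    ← ofReal_measureReal, R.real_inter_sampleEvent ht i hH hB, ENNReal.ofReal_mul h0,
    ofReal_measureReal]

lemma integrable_sampleProb (R : Run M c σ δ D ρ T μ) {t : ℕ} (ht : t < T)
    (i : S × A × S × S) : Integrable (fun ω => sampleProb M δ (R.lam t ω) i) μ := by
  have : IsProbabilityMeasure (M.rewardLaw i.1 i.2.2.1 i.2.1) := M.rewardLaw_prob _ _ _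
  refine (integrable_congr (R.sample_law t ht i.1 i.2.1 i.2.2.1 i.2.2.2 Set.univ
    MeasurableSet.univ)).1 integrable_condExp |>.congr ?_
  refine Filter.Eventually.of_forall fun ω => ?_
  simp only [probReal_univ, mul_one, sampleProb]

lemma integrable_indicator_rew (R : Run M c σ δ D ρ T μ) {t : ℕ} (ht : t < T)
    (i : S × A × S × S) {φ : ℝ → ℝ} (hφ : Integrable φ (sampleLaw M i)) :
    Integrable ((R.sampleEvent t i).indicator fun ω => φ (R.rew t ω)) μ := by
  have hrew : Measurable (R.rew t) := (R.rew_meas t ht).mono (R.ℱ.le _) le_rfl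
  have hE : MeasurableSet (R.sampleEvent t i) :=
    R.ℱ.le _ _ (R.measurableSet_sampleEvent ht i)
  rw [integrable_indicator_iff hE]
  have h1 := R.map_rew_restrict ht i (H := Set.univ) MeasurableSet.univ
  rw [Set.univ_inter] at h1
  have h2 : Integrable φ ((μ.restrict (R.sampleEvent t i)).map (R.rew t)) := by
    rw [h1]
    exact hφ.smul_measure ENNReal.ofReal_ne_top
  exact h2.comp_measurable hrew

lemma condExp_indicator_rew (R : Run M c σ δ D ρ T μ) {t : ℕ} (ht : t < T)
    (i : S × A × S × S) {φ : ℝ → ℝ} (hφ : Integrable φ (sampleLaw M i)) :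
    (fun ω => sampleProb M δ (R.lam t ω) i * ∫ x, φ x ∂(sampleLaw M i)) =ᵐ[μ]
      μ[(R.sampleEvent t i).indicator fun ω => φ (R.rew t ω) | R.ℱ t] := by
  have hrew : Measurable (R.rew t) := (R.rew_meas t ht).mono (R.ℱ.le _) le_rfl
  have hE : MeasurableSet (R.sampleEvent t i) :=
    R.ℱ.le _ _ (R.measurableSet_sampleEvent ht i)
  refine ae_eq_condExp_of_forall_setIntegral_eq (R.ℱ.le t) (R.integrable_indicator_rew ht i hφ)
    (fun _ _ _ => ((R.integrable_sampleProb ht i).mul_const _).integrableOn)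
    (fun H hH _ => ?_)
    ((R.measurable_sampleProb ht.le i).mul_const _).aestronglyMeasurable
  have : IsProbabilityMeasure (sampleLaw M i) := M.rewardLaw_prob _ _ _
  have h0 : 0 ≤ ∫ ω in H, sampleProb M δ (R.lam t ω) i ∂μ := by
    have h1 := R.real_inter_sampleEvent ht i hH MeasurableSet.univ
    rw [probReal_univ, mul_one] at h1
    rw [← h1]
    exact measureReal_nonneg
  have h1 := R.map_rew_restrict ht i hH
  have h2 : AEStronglyMeasurable φ ((μ.restrict (H ∩ R.sampleEvent t i)).map (R.rew t)) := by
    rw [h1]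
    exact (hφ.smul_measure ENNReal.ofReal_ne_top).aestronglyMeasurable
  rw [setIntegral_indicator hE, ← integral_map hrew.aemeasurable h2, h1, integral_smul_measure,
    ENNReal.toReal_ofReal h0, integral_mul_const, smul_eq_mul]

/-- A run prescribes only the conditional law of the reward, so the range is recovered almost surely
on each of the finitely many sample events. -/
lemma rew_mem (R : Run M c σ δ D ρ T μ) {t : ℕ} (ht : t < T) :
    ∀ᵐ ω ∂μ, R.rew t ω ∈ Set.Icc (0 : ℝ) 1 := by
  have hrew : Measurable (R.rew t) := (R.rew_meas t ht).mono (R.ℱ.le _) le_rfl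
  have h : ∀ i, ∀ᵐ ω ∂μ, ω ∈ R.sampleEvent t i → R.rew t ω ∈ Set.Icc (0 : ℝ) 1 := fun i => by
    rw [← ae_restrict_iff' (R.ℱ.le _ _ (R.measurableSet_sampleEvent ht i))]
    have h1 := R.map_rew_restrict ht i (H := Set.univ) MeasurableSet.univ
    rw [Set.univ_inter] at h1
    refine ae_of_ae_map hrew.aemeasurable (p := fun x => x ∈ Set.Icc (0 : ℝ) 1) ?_
    rw [h1]
    exact Measure.ae_smul_measure (M.rewardLaw_mem _ _ _) _
  filter_upwards [ae_all_iff.2 h] with ω hω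
  exact hω _ ((R.mem_sampleEvent t _ ω).2 rfl)

/-- The expectation of a function of the history, the sample, and the revealed reward. -/
lemma integral_sample (R : Run M c σ δ D ρ T μ) {t : ℕ} (ht : t < T) {φ : ℝ → ℝ}
    (hφ : ∀ i, Integrable φ (sampleLaw M i)) {f : S × A × S × S → Ω → ℝ} {b : ℝ}
    (hf : ∀ i, Measurable[R.ℱ t] (f i)) (hb : ∀ i ω, |f i ω| ≤ b) :
    Integrable (fun ω => f (R.sample t ω) ω * φ (R.rew t ω)) μ ∧
    ∫ ω, f (R.sample t ω) ω * φ (R.rew t ω) ∂μ =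
      ∫ ω, ∑ i, f i ω * (sampleProb M δ (R.lam t ω) i * ∫ x, φ x ∂(sampleLaw M i)) ∂μ := by
  have hg := fun i => R.integrable_indicator_rew ht i (hφ i)
  have hsum : (fun ω => f (R.sample t ω) ω * φ (R.rew t ω)) =
      fun ω => ∑ i, (f i * (R.sampleEvent t i).indicator fun ω => φ (R.rew t ω)) ω := by
    funext ω
    rw [Finset.sum_eq_single (R.sample t ω)]
    · rw [Pi.mul_apply, Set.indicator_of_mem ((R.mem_sampleEvent t _ ω).2 rfl)]
    · intro i _ hi
      rw [Pi.mul_apply,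
        Set.indicator_of_notMem (fun h => hi ((R.mem_sampleEvent t _ ω).1 h).symm), mul_zero]
    · simp
  have hint : ∀ i, Integrable
      (f i * (R.sampleEvent t i).indicator fun ω => φ (R.rew t ω)) μ := fun i =>
    (hg i).bdd_mul (c := b) ((hf i).mono (R.ℱ.le t) le_rfl).aestronglyMeasurable
      (Filter.Eventually.of_forall fun ω => hb i ω)
  have hint' : ∀ i, Integrable
      (fun ω => f i ω * (sampleProb M δ (R.lam t ω) i * ∫ x, φ x ∂(sampleLaw M i))) μ := fun i =>
    ((R.integrable_sampleProb ht i).mul_const _).bdd_mul (c := b)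
      ((hf i).mono (R.ℱ.le t) le_rfl).aestronglyMeasurable
      (Filter.Eventually.of_forall fun ω => hb i ω)
  rw [hsum]
  refine ⟨integrable_finsetSum _ fun i _ => hint i, ?_⟩
  rw [integral_finsetSum _ fun i _ => hint i, integral_finsetSum _ fun i _ => hint' i]
  refine Finset.sum_congr rfl fun i _ => ?_
  rw [← integral_condExp (R.ℱ.le t)]
  refine integral_congr_ae ?_
  filter_upwards [condExp_stronglyMeasurable_mul_of_bound (R.ℱ.le t) (hf i).stronglyMeasurable
    (hg i) b (Filter.Eventually.of_forall fun ω => hb i ω),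
    R.condExp_indicator_rew ht i (hφ i)] with ω h1 h2
  rw [h1, Pi.mul_apply, ← h2]

lemma integral_sample_one (R : Run M c σ δ D ρ T μ) {t : ℕ} (ht : t < T)
    {f : S × A × S × S → Ω → ℝ} {b : ℝ}
    (hf : ∀ i, Measurable[R.ℱ t] (f i)) (hb : ∀ i ω, |f i ω| ≤ b) :
    Integrable (fun ω => f (R.sample t ω) ω) μ ∧
    ∫ ω, f (R.sample t ω) ω ∂μ = ∫ ω, ∑ i, f i ω * sampleProb M δ (R.lam t ω) i ∂μ := by
  have hp : ∀ i, IsProbabilityMeasure (sampleLaw M i) := fun i => M.rewardLaw_prob _ _ _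
  have h := R.integral_sample ht (φ := fun _ => 1) (fun i => integrable_const _) hf hb
  simpa using h

end Run

end Sampling

/-! ### Importance weights and finite sums over samples. -/

section SampleAlgebra

variable {S A : Type*} [Fintype S] [Fintype A] {γ δ : ℝ} {lam : S → A → ℝ}

/-! ### Conditional means of the stochastic gradients -/

/-- This δ-dependent floor serves positivity and integrability only; it never enters the rate. -/
lemma zeta_ge [Nonempty S] [Nonempty A] (hγ : γ < 1) (hδ : δ ∈ Set.Ioo (0 : ℝ) (1 / 2))
    (hlam : ∀ s a, 0 ≤ lam s a) (s : S) (a : A) : δ / numSA S A ≤ zeta γ δ lam s a := by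
  have h1 : 0 ≤ 1 - δ := by linarith [hδ.2]
  have h2 : 0 ≤ 1 - γ := by linarith
  have := hlam s a
  unfold zeta
  have : 0 ≤ (1 - δ) * (1 - γ) * lam s a := by positivity
  linarith

lemma zeta_pos [Nonempty S] [Nonempty A] (hγ : γ < 1) (hδ : δ ∈ Set.Ioo (0 : ℝ) (1 / 2))
    (hlam : ∀ s a, 0 ≤ lam s a) (s : S) (a : A) : 0 < zeta γ δ lam s a := by
  refine lt_of_lt_of_le ?_ (zeta_ge hγ hδ hlam s a)
  have := hδ.1
  unfold numSA
  positivity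

/-- Since 1 - δ ≥ 1/2, ζ dominates (1 - γ)λ/2. The bound is free of δ, and this is what the rate
uses. -/
lemma div_zeta_le [Nonempty S] [Nonempty A] (hγ : γ < 1) (hδ : δ ∈ Set.Ioo (0 : ℝ) (1 / 2))
    (hlam : ∀ s a, 0 ≤ lam s a) (s : S) (a : A) :
    lam s a / zeta γ δ lam s a ≤ 2 / (1 - γ) := by
  have hg : 0 < 1 - γ := by linarith
  rw [div_le_div_iff₀ (zeta_pos hγ hδ hlam s a) hg]
  have h0 := hlam s a
  have h1 : 0 < δ / numSA S A := by
    have := hδ.1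
    unfold numSA
    positivity
  have h2 : 1 / 2 * ((1 - γ) * lam s a) ≤ (1 - δ) * ((1 - γ) * lam s a) :=
    mul_le_mul_of_nonneg_right (by linarith [hδ.2]) (by positivity)
  unfold zeta
  linarith

lemma sum_zeta [Nonempty S] [Nonempty A] (hγ : γ < 1) (hlam : lam ∈ dualSet S A γ) :
    ∑ s, ∑ a, zeta γ δ lam s a = 1 := by
  have hg : 1 - γ ≠ 0 := by linarith
  simp only [zeta, Finset.sum_add_distrib, ← Finset.mul_sum, sum_of_mem_dualSet hlam,
    Finset.sum_const, Finset.card_univ, nsmul_eq_mul, numSA]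
  field_simp
  ring

variable (M : MDP S A)

lemma sum_sampleProb_mul [Nonempty S] (F : S → A → S → ℝ) :
    ∑ i, F i.1 i.2.1 i.2.2.1 * Run.sampleProb M δ lam i =
      ∑ s, ∑ a, zeta M.γ δ lam s a * ∑ s', M.P a s s' * F s a s' := by
  simp only [Fintype.sum_prod_type, Run.sampleProb]
  refine Finset.sum_congr rfl fun s _ => Finset.sum_congr rfl fun a _ => ?_
  rw [Finset.mul_sum]
  refine Finset.sum_congr rfl fun s' _ => ?_
  simp only [← mul_assoc, ← Finset.mul_sum, sum_xi]
  ring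

lemma sum_sampleProb_mul_last [Nonempty S] [Nonempty A] (hlam : lam ∈ dualSet S A M.γ)
    (F : S → ℝ) : ∑ i, F i.2.2.2 * Run.sampleProb M δ lam i = ∑ s, xi S s * F s := by
  simp only [Fintype.sum_prod_type, Run.sampleProb]
  have h : ∀ s a s', ∑ s₀, F s₀ * (zeta M.γ δ lam s a * M.P a s s' * xi S s₀) =
      zeta M.γ δ lam s a * (M.P a s s' * ∑ s₀, xi S s₀ * F s₀) := fun s a s' => by
    simp only [Finset.mul_sum]
    exact Finset.sum_congr rfl fun _ _ => by ring
  simp only [h, ← Finset.mul_sum, ← Finset.sum_mul, M.P_sum, one_mul, sum_zeta M.γ_lt_one hlam]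

lemma sum_sampleProb [Nonempty S] [Nonempty A] (hlam : lam ∈ dualSet S A M.γ) :
    ∑ i, Run.sampleProb M δ lam i = 1 := by
  have := sum_sampleProb_mul_last (δ := δ) M hlam fun _ => 1
  simpa [sum_xi] using this

variable [DecidableEq S] [DecidableEq A]

/-- The stochastic primal gradient at the sample `i = (s, a, s', s₀)`. -/
noncomputable def sampleGrad (γ δ : ℝ) (lam : S → A → ℝ) (i : S × A × S × S) (x : S) : ℝ :=
  gradV γ δ lam i.1 i.2.1 i.2.2.1 i.2.2.2 x

lemma sampleGrad_eq [Nonempty S] [Nonempty A] (hγ : γ < 1) (hδ : δ ∈ Set.Ioo (0 : ℝ) (1 / 2))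
    (hlam : ∀ s a, 0 ≤ lam s a) (i : S × A × S × S) (x : S) :
    sampleGrad γ δ lam i x = e i.2.2.2 x +
      lam i.1 i.2.1 / zeta γ δ lam i.1 i.2.1 * (γ * e i.2.2.1 x - e i.1 x) := by
  rw [sampleGrad, gradV, if_pos (zeta_pos hγ hδ hlam _ _)]

lemma sum_abs_e (s : S) : ∑ x, |e s x| = 1 := by
  simp [e, apply_ite abs]

lemma sum_abs_sampleGrad_le [Nonempty S] [Nonempty A] (hγ0 : 0 ≤ γ) (hγ : γ < 1)
    (hδ : δ ∈ Set.Ioo (0 : ℝ) (1 / 2)) (hlam : ∀ s a, 0 ≤ lam s a) (i : S × A × S × S) :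
    ∑ x, |sampleGrad γ δ lam i x| ≤ 5 / (1 - γ) := by
  have hg : 0 < 1 - γ := by linarith
  have hz := zeta_pos hγ hδ hlam i.1 i.2.1
  have hw := div_zeta_le hγ hδ hlam i.1 i.2.1
  have hw0 : 0 ≤ lam i.1 i.2.1 / zeta γ δ lam i.1 i.2.1 := div_nonneg (hlam _ _) hz.le
  set w := lam i.1 i.2.1 / zeta γ δ lam i.1 i.2.1
  calc ∑ x, |sampleGrad γ δ lam i x|
      ≤ ∑ x, (|e i.2.2.2 x| + w * (γ * |e i.2.2.1 x| + |e i.1 x|)) := by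
        refine Finset.sum_le_sum fun x _ => ?_
        rw [sampleGrad_eq hγ hδ hlam]
        refine (abs_add_le _ _).trans ?_
        rw [abs_mul, abs_of_nonneg hw0]
        gcongr
        refine (abs_sub _ _).trans ?_
        rw [abs_mul, abs_of_nonneg hγ0]
    _ = 1 + w * (γ + 1) := by
        simp only [Finset.sum_add_distrib, ← Finset.mul_sum, sum_abs_e, mul_one]
    _ ≤ 1 / (1 - γ) + 2 / (1 - γ) * 2 := by
        gcongr
        · rw [le_div_iff₀ hg]
          linarith
        · linarith
    _ = 5 / (1 - γ) := by ring

/-- The weight λ/ζ undoes the sampling by ζ, so the gradient estimates -res λ, the derivative of the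
Lagrangian in v, without bias. -/
lemma sum_sampleGrad_mul [Nonempty S] [Nonempty A] (hδ : δ ∈ Set.Ioo (0 : ℝ) (1 / 2))
    (hlam : lam ∈ dualSet S A M.γ) (x : S) :
    ∑ i, sampleGrad M.γ δ lam i x * Run.sampleProb M δ lam i = - M.flowResidual lam x := by
  have h1 := sum_sampleProb_mul (δ := δ) (lam := lam) M fun s a s' =>
    lam s a / zeta M.γ δ lam s a * (M.γ * e s' x - e s x)
  have h2 := sum_sampleProb_mul_last (δ := δ) M hlam fun s => e s x
  simp only [sampleGrad_eq M.γ_lt_one hδ hlam.1, add_mul (e _ _), Finset.sum_add_distrib]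
  rw [h1, h2]
  have h3 : ∀ s a, zeta M.γ δ lam s a * ∑ s', M.P a s s' *
      (lam s a / zeta M.γ δ lam s a * (M.γ * e s' x - e s x)) =
      M.γ * (M.P a s x * lam s a) - (if x = s then lam s a else 0) := fun s a => by
    have hz := (zeta_pos M.γ_lt_one hδ hlam.1 s a).ne'
    have h4 : ∑ s', M.P a s s' * (lam s a / zeta M.γ δ lam s a * (M.γ * e s' x - e s x)) =
        lam s a / zeta M.γ δ lam s a * (M.γ * ∑ s', M.P a s s' * e s' x
          - (∑ s', M.P a s s') * e s x) := by
      simp only [Finset.mul_sum, Finset.sum_mul, ← Finset.sum_sub_distrib]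
      exact Finset.sum_congr rfl fun _ _ => by ring
    rw [h4, M.P_sum]
    simp only [e, mul_ite, mul_one, mul_zero, Finset.sum_ite_eq, Finset.mem_univ, if_true]
    rw [← mul_assoc, mul_div_cancel₀ _ hz]
    split_ifs <;> ring
  simp only [h3, Finset.sum_sub_distrib, MDP.flowResidual]
  have h5 : ∑ s, xi S s * e s x = xi S x := by simp [e]
  have h6 : ∑ s, ∑ a, (if x = s then lam s a else 0) = ∑ a, lam x a := by
    rw [Finset.sum_comm]
    simp
  have h7 : ∑ s, ∑ a, M.γ * (M.P a s x * lam s a) = ∑ a, M.γ * ∑ i, M.P a i x * lam i a := by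
    rw [Finset.sum_comm]
    simp only [Finset.mul_sum]
  rw [h5, h6, h7]
  ring

lemma MDP.sum_abs_flowResidual_le [Nonempty S] [Nonempty A] (hlam : lam ∈ dualSet S A M.γ) :
    ∑ s, |M.flowResidual lam s| ≤ 3 / (1 - M.γ) := by
  have hg : 0 < 1 - M.γ := by linarith [M.γ_lt_one]
  have h0 := M.γ_pos
  calc ∑ s, |M.flowResidual lam s|
      ≤ ∑ s, (∑ a, (lam s a + M.γ * ∑ i, M.P a i s * lam i a) + xi S s) := by
        refine Finset.sum_le_sum fun s _ => ?_
        have h1 : 0 ≤ ∑ a, lam s a := Finset.sum_nonneg fun a _ => hlam.1 s a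
        have h2 : 0 ≤ ∑ a, M.γ * ∑ i, M.P a i s * lam i a := Finset.sum_nonneg fun a _ =>
          mul_nonneg h0.le (Finset.sum_nonneg fun i _ => mul_nonneg (M.P_nonneg _ _ _) (hlam.1 _ _))
        have h3 := xi_nonneg s
        rw [MDP.flowResidual, Finset.sum_sub_distrib, Finset.sum_add_distrib, abs_le]
        constructor <;> linarith
    _ = (1 - M.γ)⁻¹ + M.γ * (1 - M.γ)⁻¹ + 1 := by
        simp only [Finset.sum_add_distrib, sum_xi, sum_of_mem_dualSet hlam]
        congr 2
        simp only [← Finset.mul_sum]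
        congr 1
        rw [← sum_of_mem_dualSet hlam, Finset.sum_comm]
        refine Eq.trans (Finset.sum_congr rfl fun a _ => ?_) Finset.sum_comm
        rw [Finset.sum_comm]
        simp only [← Finset.sum_mul, M.P_sum, one_mul]
    _ ≤ 3 / (1 - M.γ) := by
        rw [inv_eq_one_div, le_div_iff₀ hg]
        field_simp
        nlinarith [M.γ_lt_one]

/-- The Lagrangian identity: the flow violation of `lam` against that of a feasible `k`. -/
lemma MDP.sum_mul_flowResidual {k : S → A → ℝ} (hk : k ∈ M.feasible) (v : S → ℝ) :
    ∑ s, v s * M.flowResidual lam s =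
      ∑ s, ∑ a, (k s a - lam s a) * (M.γ * ∑ s', M.P a s s' * v s' - v s) := by
  have h : ∀ l : S → A → ℝ, ∑ s, v s * M.flowResidual l s =
      ∑ s, ∑ a, l s a * (v s - M.γ * ∑ s', M.P a s s' * v s') - ∑ s, v s * xi S s := fun l => by
    simp only [MDP.flowResidual, mul_sub, Finset.sum_sub_distrib, Finset.mul_sum]
    congr 1
    congr 1
    · exact Finset.sum_congr rfl fun s _ => Finset.sum_congr rfl fun a _ => by ring
    · have : ∀ s a, ∑ i, v s * (M.γ * (M.P a i s * l i a)) =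
        ∑ i, l i a * (M.γ * (M.P a i s * v s)) := fun s a =>
          Finset.sum_congr rfl fun i _ => by ring
      simp only [this]
      exact Finset.sum_comm.trans ((Finset.sum_congr rfl fun a _ => Finset.sum_comm).trans
        Finset.sum_comm)
  have h1 := h k
  simp only [hk.2, mul_zero, Finset.sum_const_zero] at h1
  rw [h lam, ← sub_zero (_ - _), h1, sub_sub_sub_cancel_right, ← Finset.sum_sub_distrib]
  refine Finset.sum_congr rfl fun s _ => ?_
  rw [← Finset.sum_sub_distrib]
  exact Finset.sum_congr rfl fun a _ => by ring

end SampleAlgebra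

lemma integral_add_add_const_mul {Ω : Type*} [MeasurableSpace Ω] {μ : Measure Ω}
    {f₁ f₂ f₃ : Ω → ℝ} (h₁ : Integrable f₁ μ) (h₂ : Integrable f₂ μ) (h₃ : Integrable f₃ μ)
    (r : ℝ) : ∫ ω, (f₁ ω + f₂ ω + r * f₃ ω) ∂μ =
      ∫ ω, f₁ ω ∂μ + ∫ ω, f₂ ω ∂μ + r * ∫ ω, f₃ ω ∂μ := by
  have h₁₂ : Integrable (fun ω => f₁ ω + f₂ ω) μ := h₁.add h₂
  rw [integral_add h₁₂ (h₃.const_mul r), integral_add h₁ h₂, integral_const_mul]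

/-! ### Moments of the stochastic gradients along a run. -/

section Moments

variable {S A : Type*} [Fintype S] [Fintype A]

lemma abs_le_norm1 (x : S → A → ℝ) (s : S) (a : A) : |x s a| ≤ norm1 x := by
  refine le_trans ?_ (Finset.single_le_sum (f := fun s => ∑ a, |x s a|)
    (fun s _ => Finset.sum_nonneg fun a _ => abs_nonneg _) (Finset.mem_univ s))
  exact Finset.single_le_sum (f := fun a => |x s a|) (fun a _ => abs_nonneg _) (Finset.mem_univ a)

lemma sum_sq_le_sq_sum_abs (x : S → ℝ) : ∑ s, x s ^ 2 ≤ (∑ s, |x s|) ^ 2 := by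
  have := Finset.sum_sq_le_sq_sum_of_nonneg (s := Finset.univ) (f := fun s => |x s|)
    fun s _ => abs_nonneg _
  simpa using this

variable [DecidableEq S] [DecidableEq A]
  {M : MDP S A} {c σ δ : ℝ} {D : Set (S → A → ℝ)} {ρ : (S → A → ℝ) → ℝ} {T : ℕ}
  {Ω : Type*} [mΩ : MeasurableSpace Ω] {μ : Measure Ω}

namespace Run

/-- The stochastic primal gradient of iteration `t`. -/
noncomputable def grad (R : Run M c σ δ D ρ T μ) (t : ℕ) (ω : Ω) (x : S) : ℝ :=
  sampleGrad M.γ δ (R.lam t ω) (R.sample t ω) x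

/-- The centred noise of the stochastic primal gradient of iteration `t`. -/
noncomputable def noise (R : Run M c σ δ D ρ T μ) (t : ℕ) (ω : Ω) (x : S) : ℝ :=
  - M.flowResidual (R.lam t ω) x - R.grad t ω x

/-- The stochastic dual supergradient of iteration `t`. -/
noncomputable def supergrad (R : Run M c σ δ D ρ T μ) (t : ℕ) (ω : Ω) : S → A → ℝ :=
  gradLam M.γ δ c σ (R.v t ω) (R.lam t ω) (R.st t ω) (R.act t ω) (R.nxt t ω) (R.rew t ω) (R.g t ω)

/-- The conditional mean of the stochastic subgradient of iteration `t`. -/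
noncomputable def meanSubgrad (R : Run M c σ δ D ρ T μ) (t : ℕ) (ω : Ω) (s : S) (a : A) : ℝ :=
  (μ[fun ω' => R.g t ω' s a | R.ℱ t]) ω

variable [Nonempty S] [Nonempty A]

lemma measurable_flowResidual (R : Run M c σ δ D ρ T μ) {t : ℕ} (ht : t ≤ T) (x : S) :
    Measurable[R.ℱ t] fun ω => M.flowResidual (R.lam t ω) x :=
  (Finset.measurable_fun_sum _ fun _ _ => (R.measurable_lam ht _ _).sub
    ((Finset.measurable_fun_sum _ fun _ _ => (R.measurable_lam ht _ _).const_mul _).const_mul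
      _)).sub_const _

lemma measurable_sampleGrad (R : Run M c σ δ D ρ T μ) (hcσ : 0 ≤ c * σ) (hn : 1 < numSA S A)
    (hδ : δ ∈ Set.Ioo (0 : ℝ) (1 / 2)) {t : ℕ} (ht : t ≤ T) (i : S × A × S × S) (x : S) :
    Measurable[R.ℱ t] fun ω => sampleGrad M.γ δ (R.lam t ω) i x := by
  have : (fun ω => sampleGrad M.γ δ (R.lam t ω) i x) = fun ω => e i.2.2.2 x +
      R.lam t ω i.1 i.2.1 / zeta M.γ δ (R.lam t ω) i.1 i.2.1 * (M.γ * e i.2.2.1 x - e i.1 x) := by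
    funext ω
    exact sampleGrad_eq M.γ_lt_one hδ (R.lam_mem hcσ hn ht ω).1 i x
  rw [this]
  exact (((R.measurable_lam ht _ _).div (R.measurable_zeta ht _ _)).mul_const _).const_add _

lemma sum_abs_grad_le (R : Run M c σ δ D ρ T μ) (hcσ : 0 ≤ c * σ) (hn : 1 < numSA S A)
    (hδ : δ ∈ Set.Ioo (0 : ℝ) (1 / 2)) {t : ℕ} (ht : t ≤ T) (ω : Ω) :
    ∑ x, |R.grad t ω x| ≤ 5 / (1 - M.γ) :=
  sum_abs_sampleGrad_le M.γ_pos.le M.γ_lt_one hδ (R.lam_mem hcσ hn ht ω).1 _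

lemma sum_abs_sampleNoise_le (R : Run M c σ δ D ρ T μ) (hcσ : 0 ≤ c * σ) (hn : 1 < numSA S A)
    (hδ : δ ∈ Set.Ioo (0 : ℝ) (1 / 2)) {t : ℕ} (ht : t ≤ T) (i : S × A × S × S) (ω : Ω) :
    ∑ x, |- M.flowResidual (R.lam t ω) x - sampleGrad M.γ δ (R.lam t ω) i x| ≤
      8 / (1 - M.γ) := by
  have h1 := sum_abs_sampleGrad_le M.γ_pos.le M.γ_lt_one hδ (R.lam_mem hcσ hn ht ω).1 i
  have h2 := M.sum_abs_flowResidual_le (R.lam_mem hcσ hn ht ω)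
  calc _ ≤ ∑ x, (|M.flowResidual (R.lam t ω) x| + |sampleGrad M.γ δ (R.lam t ω) i x|) := by
        refine Finset.sum_le_sum fun x _ => ?_
        rw [← abs_neg (M.flowResidual _ _)]
        exact abs_sub _ _
    _ ≤ 3 / (1 - M.γ) + 5 / (1 - M.γ) := by
        rw [Finset.sum_add_distrib]
        exact add_le_add h2 h1
    _ = 8 / (1 - M.γ) := by ring

lemma measurable_noise (R : Run M c σ δ D ρ T μ) (hcσ : 0 ≤ c * σ) (hn : 1 < numSA S A)
    (hδ : δ ∈ Set.Ioo (0 : ℝ) (1 / 2)) {t : ℕ} (ht : t < T) (x : S) :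
    Measurable[R.ℱ (t + 1)] fun ω => R.noise t ω x :=
  R.measurable_of_sample ht (f := fun i ω =>
    - M.flowResidual (R.lam t ω) x - sampleGrad M.γ δ (R.lam t ω) i x) fun i =>
    ((R.measurable_flowResidual ht.le x).neg.sub
      (R.measurable_sampleGrad hcσ hn hδ ht.le i x)).mono (R.ℱ.mono (Nat.le_succ t)) le_rfl

variable [IsProbabilityMeasure μ]

/-- The noise is a martingale difference. It is used with `Y` the primal iterate and with `Y` the
noise accumulated so far. -/
lemma integral_mul_noise (R : Run M c σ δ D ρ T μ) (hcσ : 0 ≤ c * σ) (hn : 1 < numSA S A)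
    (hδ : δ ∈ Set.Ioo (0 : ℝ) (1 / 2)) {t : ℕ} (ht : t < T) {Y : Ω → S → ℝ} {b : ℝ}
    (hY : ∀ x, Measurable[R.ℱ t] fun ω => Y ω x) (hb : ∀ ω x, |Y ω x| ≤ b) :
    Integrable (fun ω => ∑ x, Y ω x * R.noise t ω x) μ ∧
      ∫ ω, ∑ x, Y ω x * R.noise t ω x ∂μ = 0 := by
  have h := R.integral_sample_one ht (b := b * (8 / (1 - M.γ)))
    (f := fun i ω => ∑ x, Y ω x *
      (- M.flowResidual (R.lam t ω) x - sampleGrad M.γ δ (R.lam t ω) i x))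
    (fun i => Finset.measurable_fun_sum _ fun x _ => (hY x).mul
      ((R.measurable_flowResidual ht.le x).neg.sub (R.measurable_sampleGrad hcσ hn hδ ht.le i x)))
    (fun i ω => by
      have hb0 : 0 ≤ b := (abs_nonneg _).trans (hb ω (Classical.arbitrary S))
      refine (Finset.abs_sum_le_sum_abs _ _).trans ?_
      refine le_trans (Finset.sum_le_sum fun x _ => ?_)
        (mul_le_mul_of_nonneg_left (R.sum_abs_sampleNoise_le hcσ hn hδ ht.le i ω) hb0 |>.trans'
          (le_of_eq (Finset.mul_sum _ _ _).symm))
      rw [abs_mul]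
      exact mul_le_mul_of_nonneg_right (hb ω x) (abs_nonneg _))
  refine ⟨h.1, h.2.trans ?_⟩
  rw [← integral_zero Ω ℝ (μ := μ)]
  congr 1
  funext ω
  have hmem := R.lam_mem hcσ hn ht.le ω
  simp only [Finset.sum_mul]
  rw [Finset.sum_comm]
  refine Finset.sum_eq_zero fun x _ => ?_
  have h1 : ∀ i, Y ω x * (- M.flowResidual (R.lam t ω) x - sampleGrad M.γ δ (R.lam t ω) i x) *
      sampleProb M δ (R.lam t ω) i = Y ω x * (- M.flowResidual (R.lam t ω) x *
        sampleProb M δ (R.lam t ω) i - sampleGrad M.γ δ (R.lam t ω) i x *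
        sampleProb M δ (R.lam t ω) i) := fun i => by ring
  simp only [h1, ← Finset.mul_sum, Finset.sum_sub_distrib, sum_sampleProb M hmem,
    sum_sampleGrad_mul M hδ hmem]
  ring

lemma abs_sum_noise_le (R : Run M c σ δ D ρ T μ) (hcσ : 0 ≤ c * σ) (hn : 1 < numSA S A)
    (hδ : δ ∈ Set.Ioo (0 : ℝ) (1 / 2)) {n : ℕ} (hnT : n ≤ T) (ω : Ω) (x : S) :
    |∑ t ∈ Finset.range n, R.noise t ω x| ≤ n * (8 / (1 - M.γ)) := by
  refine (Finset.abs_sum_le_sum_abs _ _).trans ?_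
  refine (Finset.sum_le_card_nsmul _ _ (8 / (1 - M.γ)) fun t ht => ?_).trans (by simp)
  have htT : t ≤ T := (Finset.mem_range.1 ht).le.trans hnT
  exact (Finset.single_le_sum (f := fun x => |R.noise t ω x|) (fun _ _ => abs_nonneg _)
    (Finset.mem_univ x)).trans (R.sum_abs_sampleNoise_le hcσ hn hδ htT _ ω)

lemma measurable_sum_noise (R : Run M c σ δ D ρ T μ) (hcσ : 0 ≤ c * σ) (hn : 1 < numSA S A)
    (hδ : δ ∈ Set.Ioo (0 : ℝ) (1 / 2)) {n : ℕ} (hnT : n ≤ T) (x : S) :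
    Measurable[R.ℱ n] fun ω => ∑ t ∈ Finset.range n, R.noise t ω x :=
  Finset.measurable_fun_sum _ fun _ ht =>
    (R.measurable_noise hcσ hn hδ ((Finset.mem_range.1 ht).trans_le hnT) x).mono
      (R.ℱ.mono (Finset.mem_range.1 ht)) le_rfl

/-- The accumulated noise has orthogonal increments. -/
lemma integral_sq_sum_noise_le (R : Run M c σ δ D ρ T μ) (hcσ : 0 ≤ c * σ) (hn : 1 < numSA S A)
    (hδ : δ ∈ Set.Ioo (0 : ℝ) (1 / 2)) {n : ℕ} (hnT : n ≤ T) :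
    Integrable (fun ω => ∑ x, (∑ t ∈ Finset.range n, R.noise t ω x) ^ 2) μ ∧
      ∫ ω, ∑ x, (∑ t ∈ Finset.range n, R.noise t ω x) ^ 2 ∂μ ≤ n * (8 / (1 - M.γ)) ^ 2 := by
  induction n with
  | zero => simp
  | succ n ih =>
    obtain ⟨ih1, ih2⟩ := ih (by omega)
    -- The cross term vanishes because the noise accumulated before iteration n is known to `ℱ n`.
    obtain ⟨h1, h2⟩ := R.integral_mul_noise hcσ hn hδ (t := n) (by omega)
      (Y := fun ω x => ∑ t ∈ Finset.range n, R.noise t ω x)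
      (R.measurable_sum_noise hcσ hn hδ (by omega))
      (R.abs_sum_noise_le hcσ hn hδ (by omega))
    have hsq : ∀ ω, ∑ x, R.noise n ω x ^ 2 ≤ (8 / (1 - M.γ)) ^ 2 := fun ω =>
      (sum_sq_le_sq_sum_abs _).trans (pow_le_pow_left₀
        (Finset.sum_nonneg fun _ _ => abs_nonneg _)
        (R.sum_abs_sampleNoise_le hcσ hn hδ (by omega) _ ω) 2)
    have h3 : Integrable (fun ω => ∑ x, R.noise n ω x ^ 2) μ := by
      refine Integrable.of_bound (C := (8 / (1 - M.γ)) ^ 2) ?_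
        (Filter.Eventually.of_forall fun ω => ?_)
      · exact (Finset.measurable_fun_sum _ fun x _ =>
          ((R.measurable_noise hcσ hn hδ (by omega) x).mono (R.ℱ.le _) le_rfl).pow_const
            2).aestronglyMeasurable
      · rw [Real.norm_eq_abs, abs_of_nonneg (Finset.sum_nonneg fun _ _ => sq_nonneg _)]
        exact hsq ω
    have hexp : (fun ω => ∑ x, (∑ t ∈ Finset.range (n + 1), R.noise t ω x) ^ 2) = fun ω =>
        ∑ x, (∑ t ∈ Finset.range n, R.noise t ω x) ^ 2
        + ∑ x, R.noise n ω x ^ 2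
        + 2 * ∑ x, (∑ t ∈ Finset.range n, R.noise t ω x) * R.noise n ω x := by
      funext ω
      simp only [Finset.mul_sum (a := (2 : ℝ)), ← Finset.sum_add_distrib]
      refine Finset.sum_congr rfl fun x _ => ?_
      rw [Finset.sum_range_succ]
      ring
    rw [hexp]
    refine ⟨(ih1.add h3).add (h1.const_mul 2), ?_⟩
    rw [integral_add_add_const_mul ih1 h3 h1, h2]
    have h4 : ∫ ω, ∑ x, R.noise n ω x ^ 2 ∂μ ≤ (8 / (1 - M.γ)) ^ 2 := by
      refine (integral_mono h3 (integrable_const _) hsq).trans (by simp)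
    push_cast
    linarith

lemma integrable_g (R : Run M c σ δ D ρ T μ) {t : ℕ} (ht : t < T) (s : S) (a : A) :
    Integrable (fun ω => R.g t ω s a) μ := by
  refine Integrable.of_bound (C := σ) ?_ ?_
  · exact (((measurable_pi_apply a).comp ((measurable_pi_apply s).comp (R.g_meas t ht))).mono
      (R.ℱ.le _) le_rfl).aestronglyMeasurable
  · filter_upwards [R.g_bound t ht] with ω hω
    exact hω s a

lemma integral_ip_meanSubgrad (R : Run M c σ δ D ρ T μ) {t : ℕ} (ht : t < T)
    {Y : Ω → S → A → ℝ} {b : ℝ} (hY : ∀ s a, Measurable[R.ℱ t] fun ω => Y ω s a)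
    (hb : ∀ ω s a, |Y ω s a| ≤ b) :
    Integrable (fun ω => ip (R.g t ω) (Y ω)) μ ∧
      Integrable (fun ω => ip (R.meanSubgrad t ω) (Y ω)) μ ∧
      ∫ ω, ip (R.g t ω) (Y ω) ∂μ = ∫ ω, ip (R.meanSubgrad t ω) (Y ω) ∂μ := by
  have hYm : ∀ s a, AEStronglyMeasurable (fun ω => Y ω s a) μ := fun s a =>
    ((hY s a).mono (R.ℱ.le t) le_rfl).aestronglyMeasurable
  have h1 : ∀ s a, Integrable (fun ω => R.g t ω s a * Y ω s a) μ := fun s a =>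
    (R.integrable_g ht s a).mul_bdd (c := b) (hYm s a)
      (Filter.Eventually.of_forall fun ω => hb ω s a)
  have h2 : ∀ s a, Integrable (fun ω => R.meanSubgrad t ω s a * Y ω s a) μ := fun s a =>
    Integrable.mul_bdd (c := b) integrable_condExp (hYm s a)
      (Filter.Eventually.of_forall fun ω => hb ω s a)
  simp only [ip]
  refine ⟨integrable_finsetSum _ fun s _ => integrable_finsetSum _ fun a _ => h1 s a,
    integrable_finsetSum _ fun s _ => integrable_finsetSum _ fun a _ => h2 s a, ?_⟩
  rw [integral_finsetSum _ fun s _ => integrable_finsetSum _ fun a _ => h1 s a,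
    integral_finsetSum _ fun s _ => integrable_finsetSum _ fun a _ => h2 s a]
  refine Finset.sum_congr rfl fun s _ => ?_
  rw [integral_finsetSum _ fun a _ => h1 s a, integral_finsetSum _ fun a _ => h2 s a]
  refine Finset.sum_congr rfl fun a _ => ?_
  rw [← integral_condExp (R.ℱ.le t)]
  exact integral_congr_ae (condExp_mul_of_stronglyMeasurable_right
    (hY s a).stronglyMeasurable (h1 s a) (R.integrable_g ht s a))

/-- Averaging 1/ζ against ζ counts the state-action pairs, whatever δ is; this is the source of the
factor |S||A| in the dual variance. -/
lemma integral_inv_zeta (R : Run M c σ δ D ρ T μ) (hcσ : 0 ≤ c * σ) (hn : 1 < numSA S A)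
    (hδ : δ ∈ Set.Ioo (0 : ℝ) (1 / 2)) {t : ℕ} (ht : t < T) :
    Integrable (fun ω => (zeta M.γ δ (R.lam t ω) (R.st t ω) (R.act t ω))⁻¹) μ ∧
      ∫ ω, (zeta M.γ δ (R.lam t ω) (R.st t ω) (R.act t ω))⁻¹ ∂μ = numSA S A := by
  have hn0 : 0 < numSA S A := by linarith
  have hδ0 := hδ.1
  have h := R.integral_sample_one ht (b := (δ / numSA S A)⁻¹)
    (f := fun i ω => (zeta M.γ δ (R.lam t ω) i.1 i.2.1)⁻¹)
    (fun i => (R.measurable_zeta ht.le _ _).inv)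
    (fun i ω => by
      have h1 := zeta_pos M.γ_lt_one hδ (R.lam_mem hcσ hn ht.le ω).1 i.1 i.2.1
      rw [abs_of_pos (inv_pos.2 h1)]
      exact inv_anti₀ (by positivity)
        (zeta_ge M.γ_lt_one hδ (R.lam_mem hcσ hn ht.le ω).1 i.1 i.2.1))
  refine ⟨h.1, h.2.trans ?_⟩
  have h2 : ∀ ω, ∑ i, (zeta M.γ δ (R.lam t ω) i.1 i.2.1)⁻¹ * sampleProb M δ (R.lam t ω) i =
      numSA S A := fun ω => by
    have h3 := sum_sampleProb_mul (δ := δ) (lam := R.lam t ω) M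
      fun s a _ => (zeta M.γ δ (R.lam t ω) s a)⁻¹
    rw [h3]
    have h4 : ∀ s a, zeta M.γ δ (R.lam t ω) s a *
        ∑ s', M.P a s s' * (zeta M.γ δ (R.lam t ω) s a)⁻¹ = 1 := fun s a => by
      rw [← Finset.sum_mul, M.P_sum, one_mul]
      exact mul_inv_cancel₀ (zeta_pos M.γ_lt_one hδ (R.lam_mem hcσ hn ht.le ω).1 s a).ne'
    simp [h4, numSA]
  simp [h2]

/-- The constant shift `shift₂` disappears because both arrays have the same mass. The reward is
isolated in its own term to match the product form required by `integral_sample`. -/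
lemma ip_supergrad (R : Run M c σ δ D ρ T μ) (hcσ : 0 ≤ c * σ) (hn : 1 < numSA S A)
    (hδ : δ ∈ Set.Ioo (0 : ℝ) (1 / 2)) {t : ℕ} (ht : t < T) {k : S → A → ℝ}
    (hk : k ∈ dualSet S A M.γ) (ω : Ω) :
    ip (R.supergrad t ω) (k - R.lam t ω) =
      (k - R.lam t ω) (R.st t ω) (R.act t ω) / zeta M.γ δ (R.lam t ω) (R.st t ω) (R.act t ω)
        * R.rew t ω
      + (k - R.lam t ω) (R.st t ω) (R.act t ω) / zeta M.γ δ (R.lam t ω) (R.st t ω) (R.act t ω)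
        * (M.γ * R.v t ω (R.nxt t ω) - R.v t ω (R.st t ω) - shift₁ M.γ c σ)
      - c * ip (R.g t ω) (k - R.lam t ω) := by
  have hmem := R.lam_mem hcσ hn ht.le ω
  have hz := zeta_pos M.γ_lt_one hδ hmem.1 (R.st t ω) (R.act t ω)
  have h0 : ∑ s, ∑ a, (k - R.lam t ω) s a = 0 := by
    simp only [Pi.sub_apply, Finset.sum_sub_distrib, sum_of_mem_dualSet hk,
      sum_of_mem_dualSet hmem, sub_self]
  set y := k - R.lam t ω
  simp only [ip, supergrad, gradLam, sub_mul, Finset.sum_sub_distrib, ite_mul, zero_mul, hz,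
    and_true, mul_assoc, ← Finset.mul_sum, h0, mul_zero, sub_zero]
  congr 1
  rw [Finset.sum_eq_single (R.st t ω), Finset.sum_eq_single (R.act t ω)]
  · simp only [and_self, if_true]
    ring
  · intro a _ ha
    simp [ha]
  · simp
  · intro s _ hs
    simp [hs]
  · simp

/-- The stochastic dual supergradient is unbiased along differences of dual arrays. -/
lemma integral_ip_supergrad (R : Run M c σ δ D ρ T μ) (hcσ : 0 ≤ c * σ) (hn : 1 < numSA S A)
    (hδ : δ ∈ Set.Ioo (0 : ℝ) (1 / 2)) {t : ℕ} (ht : t < T) {k : S → A → ℝ}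
    (hk : k ∈ dualSet S A M.γ) :
    Integrable (fun ω => ip (R.supergrad t ω) (k - R.lam t ω)) μ ∧
    Integrable (fun ω => ip (fun s a => M.r s a + (M.γ * ∑ s', M.P a s s' * R.v t ω s'
      - R.v t ω s)) (k - R.lam t ω) - c * ip (R.meanSubgrad t ω) (k - R.lam t ω)) μ ∧
    ∫ ω, ip (R.supergrad t ω) (k - R.lam t ω) ∂μ =
      ∫ ω, (ip (fun s a => M.r s a + (M.γ * ∑ s', M.P a s s' * R.v t ω s'
        - R.v t ω s)) (k - R.lam t ω) - c * ip (R.meanSubgrad t ω) (k - R.lam t ω)) ∂μ := by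
  have hg : 0 < 1 - M.γ := by linarith [M.γ_lt_one]
  have hn0 : 0 < numSA S A := by linarith
  have hδ0 := hδ.1
  have hmem := fun ω => R.lam_mem hcσ hn ht.le ω
  have hz := fun ω s a => zeta_pos M.γ_lt_one hδ (hmem ω).1 s a
  have hYm : ∀ s a, Measurable[R.ℱ t] fun ω => (k - R.lam t ω) s a := fun s a =>
    (R.measurable_lam ht.le s a).const_sub _
  have hYb : ∀ ω s a, |(k - R.lam t ω) s a| ≤ 2 * (1 - M.γ)⁻¹ := fun ω s a =>
    (abs_le_norm1 _ s a).trans (norm1_sub_le hk (hmem ω))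
  have hwm : ∀ s a, Measurable[R.ℱ t] fun ω =>
      (k - R.lam t ω) s a / zeta M.γ δ (R.lam t ω) s a := fun s a =>
    (hYm s a).div (R.measurable_zeta ht.le s a)
  have hwb : ∀ ω s a, |(k - R.lam t ω) s a / zeta M.γ δ (R.lam t ω) s a| ≤
      2 * (1 - M.γ)⁻¹ / (δ / numSA S A) := fun ω s a => by
    rw [abs_div, abs_of_pos (hz ω s a)]
    exact div_le_div₀ (by positivity) (hYb ω s a) (by positivity)
      (zeta_ge M.γ_lt_one hδ (hmem ω).1 s a)
  obtain ⟨hg1, hg2, hg3⟩ := R.integral_ip_meanSubgrad ht hYm hYb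
  obtain ⟨hr1, hr2⟩ := R.integral_sample ht (φ := fun x => x)
    (fun i => M.integrable_reward _ _ _)
    (f := fun i ω => (k - R.lam t ω) i.1 i.2.1 / zeta M.γ δ (R.lam t ω) i.1 i.2.1)
    (fun i => hwm _ _) (fun i ω => hwb ω _ _)
  set W := 2 * ((1 + c * σ) / (1 - M.γ))
  have hvb : ∀ ω s s', |M.γ * R.v t ω s' - R.v t ω s - shift₁ M.γ c σ| ≤
      W + W + |shift₁ M.γ c σ| := fun ω s s' => by
    refine (abs_sub _ _).trans (add_le_add ((abs_sub _ _).trans (add_le_add ?_ ?_)) le_rfl)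
    · rw [abs_mul, abs_of_pos M.γ_pos]
      exact (mul_le_of_le_one_left (abs_nonneg _) M.γ_lt_one.le).trans (R.v_mem ht.le ω s')
    · exact R.v_mem ht.le ω s
  obtain ⟨hv1, hv2⟩ := R.integral_sample_one ht
    (f := fun i ω => (k - R.lam t ω) i.1 i.2.1 / zeta M.γ δ (R.lam t ω) i.1 i.2.1 *
      (M.γ * R.v t ω i.2.2.1 - R.v t ω i.1 - shift₁ M.γ c σ))
    (b := 2 * (1 - M.γ)⁻¹ / (δ / numSA S A) * (W + W + |shift₁ M.γ c σ|))
    (fun i => (hwm _ _).mul ((((R.measurable_v ht.le _).const_mul _).sub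
      (R.measurable_v ht.le _)).sub_const _))
    (fun i ω => by
      rw [abs_mul]
      exact mul_le_mul (hwb ω _ _) (hvb ω _ _) (abs_nonneg _) (by positivity))
  have hcancel : ∀ ω (F : S → A → S → ℝ), ∑ i, (k - R.lam t ω) i.1 i.2.1 /
      zeta M.γ δ (R.lam t ω) i.1 i.2.1 * F i.1 i.2.1 i.2.2.1 * sampleProb M δ (R.lam t ω) i =
      ∑ s, ∑ a, (∑ s', M.P a s s' * F s a s') * (k - R.lam t ω) s a := fun ω F => by
    rw [sum_sampleProb_mul (δ := δ) (lam := R.lam t ω) M fun s a s' =>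
      (k - R.lam t ω) s a / zeta M.γ δ (R.lam t ω) s a * F s a s']
    refine Finset.sum_congr rfl fun s _ => Finset.sum_congr rfl fun a _ => ?_
    rw [Finset.mul_sum, Finset.sum_mul]
    refine Finset.sum_congr rfl fun s' _ => ?_
    have := (hz ω s a).ne'
    field_simp
  have hr3 : ∀ ω, ∑ i, (k - R.lam t ω) i.1 i.2.1 / zeta M.γ δ (R.lam t ω) i.1 i.2.1 *
      (sampleProb M δ (R.lam t ω) i * ∫ x, x ∂(sampleLaw M i)) = ip M.r (k - R.lam t ω) :=
    fun ω => by
      refine Eq.trans ?_ (hcancel ω fun s a s' => ∫ x, x ∂(M.rewardLaw s s' a))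
      exact Finset.sum_congr rfl fun i _ => by rw [sampleLaw]; ring
  -- After averaging, `shift₁` contributes a constant array, which pairs to zero with a difference
  -- of equal masses.
  have hv3 : ∀ ω, ∑ i, (k - R.lam t ω) i.1 i.2.1 / zeta M.γ δ (R.lam t ω) i.1 i.2.1 *
      (M.γ * R.v t ω i.2.2.1 - R.v t ω i.1 - shift₁ M.γ c σ) * sampleProb M δ (R.lam t ω) i =
      ip (fun s a => M.γ * ∑ s', M.P a s s' * R.v t ω s' - R.v t ω s) (k - R.lam t ω) :=
    fun ω => by
      rw [hcancel ω fun s a s' => M.γ * R.v t ω s' - R.v t ω s - shift₁ M.γ c σ]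
      have h0 : ∑ s, ∑ a, (k - R.lam t ω) s a = 0 := by
        simp only [Pi.sub_apply, Finset.sum_sub_distrib, sum_of_mem_dualSet hk,
          sum_of_mem_dualSet (hmem ω), sub_self]
      have h1 : ∀ s a, ∑ s', M.P a s s' * (M.γ * R.v t ω s' - R.v t ω s - shift₁ M.γ c σ) =
          (M.γ * ∑ s', M.P a s s' * R.v t ω s' - R.v t ω s) - shift₁ M.γ c σ := fun s a => by
        simp only [mul_sub, Finset.sum_sub_distrib, ← Finset.sum_mul, M.P_sum, Finset.mul_sum,
          one_mul]
        congr 2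
        exact Finset.sum_congr rfl fun _ _ => by ring
      simp only [h1, sub_mul _ (shift₁ M.γ c σ), Finset.sum_sub_distrib, ← Finset.mul_sum, h0,
        mul_zero, sub_zero, ip]
  simp only [hr3] at hr2
  simp only [hv3] at hv2
  have hIr : Integrable (fun ω => ip M.r (k - R.lam t ω)) μ := by
    refine Integrable.of_bound (C := 1 * (2 * (1 - M.γ)⁻¹)) ?_
      (Filter.Eventually.of_forall fun ω => (abs_ip_le M.abs_r_le).trans
        (mul_le_mul_of_nonneg_left (norm1_sub_le hk (hmem ω)) zero_le_one))
    exact (Finset.measurable_fun_sum _ fun s _ => Finset.measurable_fun_sum _ fun a _ =>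
      ((hYm s a).mono (R.ℱ.le t) le_rfl).const_mul _).aestronglyMeasurable
  have hIv : Integrable (fun ω => ip (fun s a => M.γ * ∑ s', M.P a s s' * R.v t ω s'
      - R.v t ω s) (k - R.lam t ω)) μ := by
    refine Integrable.of_bound (C := (W + W) * (2 * (1 - M.γ)⁻¹)) ?_
      (Filter.Eventually.of_forall fun ω => ?_)
    · have hm : ∀ s, Measurable fun ω => R.v t ω s := fun s =>
        (R.measurable_v ht.le s).mono (R.ℱ.le t) le_rfl
      exact (Finset.measurable_fun_sum _ fun s _ => Finset.measurable_fun_sum _ fun a _ =>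
        (((Finset.measurable_fun_sum _ fun s' _ => (hm s').const_mul _).const_mul _).sub
          (hm s)).mul ((hYm s a).mono (R.ℱ.le t) le_rfl)).aestronglyMeasurable
    · have hW0 : 0 ≤ W := (abs_nonneg _).trans (R.v_mem ht.le ω (Classical.arbitrary S))
      refine (abs_ip_le (b := W + W) fun s a => ?_).trans
        (mul_le_mul_of_nonneg_left (norm1_sub_le hk (hmem ω)) (by positivity))
      refine (abs_sub _ _).trans (add_le_add ?_ (R.v_mem ht.le ω s))
      rw [abs_mul, abs_of_pos M.γ_pos]
      refine (mul_le_of_le_one_left (abs_nonneg _) M.γ_lt_one.le).trans ?_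
      refine (Finset.abs_sum_le_sum_abs _ _).trans ?_
      calc ∑ s', |M.P a s s' * R.v t ω s'| ≤ ∑ s', M.P a s s' * W := by
            refine Finset.sum_le_sum fun s' _ => ?_
            rw [abs_mul, abs_of_nonneg (M.P_nonneg _ _ _)]
            exact mul_le_mul_of_nonneg_left (R.v_mem ht.le ω s') (M.P_nonneg _ _ _)
        _ = W := by rw [← Finset.sum_mul, M.P_sum, one_mul]
  have hsplit : ∀ ω, ip (fun s a => M.r s a + (M.γ * ∑ s', M.P a s s' * R.v t ω s'
      - R.v t ω s)) (k - R.lam t ω) = ip M.r (k - R.lam t ω) +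
      ip (fun s a => M.γ * ∑ s', M.P a s s' * R.v t ω s' - R.v t ω s) (k - R.lam t ω) :=
    fun ω => ip_add_left M.r _ _
  simp only [hsplit, R.ip_supergrad hcσ hn hδ ht hk]
  have hI1 := hr1.add hv1
  refine ⟨hI1.sub (hg1.const_mul c), (hIr.add hIv).sub (hg2.const_mul c), ?_⟩
  simp only [sub_eq_add_neg (_ + _), ← neg_mul]
  rw [integral_add_add_const_mul hIr hIv hg2, ← hg3, ← hr2, ← hv2]
  exact integral_add_add_const_mul hr1 hv1 hg1 (-c)

end Run

end Moments

/-! ### Regret bounds and the pathwise duality gap. -/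

section Regret

variable {S A : Type*} [Fintype S] [Fintype A] [DecidableEq S] [DecidableEq A]

/-! ### Deterministic bounds along a run -/

section GradLam

variable [Nonempty S] [Nonempty A] {γ δ c σ : ℝ} {v : S → ℝ} {lam : S → A → ℝ} {rew : ℝ}
  {g : S → A → ℝ}

/-- With B = (1 + cσ)/(1 - γ), the unshifted value is at most 1 + 2(1 + γ)B = 4B + 1 - 2(1 + cσ) <
4B, which explains the size 4B of `shift₁`. -/
lemma shifted_reward_mem (hγ0 : 0 ≤ γ) (hγ : γ < 1) (hcσ : 0 ≤ c * σ)
    (hv : v ∈ primalSet S γ c σ) (hrew : rew ∈ Set.Icc (0 : ℝ) 1) (s s' : S) :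
    rew + γ * v s' - v s - shift₁ γ c σ ∈ Set.Icc (-(8 * ((1 + c * σ) / (1 - γ)))) 0 := by
  have hg : 0 < 1 - γ := by linarith
  have hM : shift₁ γ c σ = 4 * ((1 + c * σ) / (1 - γ)) := by
    rw [shift₁]
    ring
  have hC : (1 + c * σ) / (1 - γ) * (1 - γ) = 1 + c * σ := div_mul_cancel₀ _ hg.ne'
  have hB : 0 ≤ (1 + c * σ) / (1 - γ) := by positivity
  have h1 := abs_le.1 (hv s)
  have h2 := abs_le.1 (hv s')
  set B := (1 + c * σ) / (1 - γ)
  have h3 := mul_le_mul_of_nonneg_left h2.2 hγ0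
  have h4 := mul_le_mul_of_nonneg_left h2.1 hγ0
  rw [hM]
  constructor
  · have : γ * B ≤ B := mul_le_of_le_one_left hB hγ.le
    linarith [hrew.1]
  · linarith [hrew.2]

lemma gradLam_nonpos (hγ0 : 0 ≤ γ) (hγ : γ < 1) (hδ : δ ∈ Set.Ioo (0 : ℝ) (1 / 2)) (hc : 0 ≤ c)
    (hcσ : 0 ≤ c * σ) (hlam : ∀ s a, 0 ≤ lam s a) (hv : v ∈ primalSet S γ c σ)
    (hrew : rew ∈ Set.Icc (0 : ℝ) 1) (hg : ∀ s a, |g s a| ≤ σ) (s : S) (a : A) (s' : S) (x : S)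
    (y : A) : gradLam γ δ c σ v lam s a s' rew g x y ≤ 0 := by
  have h1 := mul_le_mul_of_nonneg_left (abs_le.1 (hg x y)).1 hc
  have h2 : (if x = s ∧ y = a ∧ 0 < zeta γ δ lam s a
      then (rew + γ * v s' - v s - shift₁ γ c σ) / zeta γ δ lam s a else 0) ≤ 0 := by
    split_ifs
    · exact div_nonpos_of_nonpos_of_nonneg (shifted_reward_mem hγ0 hγ hcσ hv hrew s s').2
        (zeta_pos hγ hδ hlam s a).le
    · exact le_rfl
  rw [gradLam, shift₂]
  linarith

/-- Splitting the square by (x + y)² ≤ 2x² + 2y², the sampled entry contributes 2(λ/ζ)q²/ζ with λ/ζ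
≤ 2/(1 - γ) and |q| ≤ 8B, hence 256 = 2 · 2 · 64. One factor 1/ζ is left for the expectation. -/
lemma sum_mul_sq_gradLam_le (hγ0 : 0 ≤ γ) (hγ : γ < 1) (hδ : δ ∈ Set.Ioo (0 : ℝ) (1 / 2))
    (hc : 0 ≤ c) (hcσ : 0 ≤ c * σ) (hlam : lam ∈ dualSet S A γ) (hv : v ∈ primalSet S γ c σ)
    (hrew : rew ∈ Set.Icc (0 : ℝ) 1) (hg : ∀ s a, |g s a| ≤ σ) (s : S) (a : A) (s' : S) :
    ∑ x, ∑ y, lam x y * gradLam γ δ c σ v lam s a s' rew g x y ^ 2 ≤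
      256 * ((1 + c * σ) / (1 - γ)) ^ 2 / (1 - γ) * (zeta γ δ lam s a)⁻¹
        + 8 * (c * σ) ^ 2 / (1 - γ) := by
  have hz := zeta_pos hγ hδ hlam.1 s a
  have hw := div_zeta_le hγ hδ hlam.1 s a
  have hmem := shifted_reward_mem hγ0 hγ hcσ hv hrew s s'
  set B := (1 + c * σ) / (1 - γ)
  set q := rew + γ * v s' - v s - shift₁ γ c σ
  set z := zeta γ δ lam s a with hzdef
  have hq2 : q ^ 2 ≤ 64 * B ^ 2 := by
    have := sq_le_sq' (by linarith [hmem.1] : -(8 * B) ≤ q) (by linarith [hmem.2, hmem.1])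
    linarith [mul_pow 8 B 2]
  have hpt : ∀ x y, lam x y * gradLam γ δ c σ v lam s a s' rew g x y ^ 2 ≤
      (if x = s then if y = a then 2 * (lam s a * (q / z) ^ 2) else 0 else 0)
        + 8 * (c * σ) ^ 2 * lam x y := fun x y => by
    have hl := hlam.1 x y
    have h1 := mul_le_mul_of_nonneg_left (abs_le.1 (hg x y)).1 hc
    have h2 := mul_le_mul_of_nonneg_left (abs_le.1 (hg x y)).2 hc
    have h3 : (c * g x y + c * σ) ^ 2 ≤ 4 * (c * σ) ^ 2 := by
      have := sq_le_sq' (by linarith : -(2 * (c * σ)) ≤ c * g x y + c * σ) (by linarith)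
      linarith [mul_pow 2 (c * σ) 2]
    rw [gradLam, shift₂]
    by_cases hxy : x = s ∧ y = a
    · obtain ⟨rfl, rfl⟩ := hxy
      simp only [true_and, ← hzdef, hz, if_true]
      have h4 : (q / z - c * g x y - c * σ) ^ 2 ≤ 2 * (q / z) ^ 2 + 8 * (c * σ) ^ 2 := by
        nlinarith [sq_nonneg (q / z + (c * g x y + c * σ))]
      have := mul_le_mul_of_nonneg_left h4 hl
      linarith
    · have h5 : ¬ (x = s ∧ y = a ∧ 0 < z) := fun h => hxy ⟨h.1, h.2.1⟩
      have h6 : (if x = s then if y = a then 2 * (lam s a * (q / z) ^ 2) else 0 else 0) = 0 := by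
        split_ifs with h7 h8
        · exact absurd ⟨h7, h8⟩ hxy
        · rfl
        · rfl
      rw [if_neg h5, h6]
      have h4 : (0 - c * g x y - c * σ) ^ 2 ≤ 8 * (c * σ) ^ 2 := by
        nlinarith [sq_nonneg (c * σ)]
      have := mul_le_mul_of_nonneg_left h4 hl
      linarith
  refine (Finset.sum_le_sum fun x _ => Finset.sum_le_sum fun y _ => hpt x y).trans ?_
  simp only [Finset.sum_add_distrib, ← Finset.mul_sum, sum_of_mem_dualSet hlam]
  have h7 : ∑ x, ∑ y, (if x = s then if y = a then 2 * (lam s a * (q / z) ^ 2) else 0 else 0) =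
      2 * (lam s a * (q / z) ^ 2) := by
    rw [Finset.sum_eq_single s]
    · simp
    · intro x _ hx
      simp [hx]
    · simp
  rw [h7, ← div_eq_mul_inv]
  refine add_le_add ?_ le_rfl
  have h8 : 2 * (lam s a * (q / z) ^ 2) = 2 * (lam s a / z) * q ^ 2 * z⁻¹ := by
    field_simp
  rw [h8]
  refine mul_le_mul_of_nonneg_right ?_ (inv_pos.2 hz).le
  have hw0 : 0 ≤ lam s a / z := div_nonneg (hlam.1 s a) hz.le
  calc 2 * (lam s a / z) * q ^ 2 ≤ 2 * (2 / (1 - γ)) * (64 * B ^ 2) := by gcongr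
    _ = 256 * B ^ 2 / (1 - γ) := by ring

end GradLam

variable {M : MDP S A} {c σ δ : ℝ} {D : Set (S → A → ℝ)} {ρ : (S → A → ℝ) → ℝ} {T : ℕ}
  {Ω : Type*} [mΩ : MeasurableSpace Ω] {μ : Measure Ω} [Nonempty S] [Nonempty A]

namespace Run

/-- The potential ∑ k log λᵗ telescopes. The uniform start and the entrywise bound λᵀ ≤ (1 - γ)⁻¹
limit its total increase to log n per unit of mass of `k`. -/
lemma dual_regret_le (R : Run M c σ δ D ρ T μ) (hc : 0 ≤ c) (hcσ : 0 ≤ c * σ)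
    (hn : 1 < numSA S A) (hδ : δ ∈ Set.Ioo (0 : ℝ) (1 / 2)) (hT : 0 < T) {k : S → A → ℝ}
    (hk : k ∈ dualSet S A M.γ) {ω : Ω}
    (hrew : ∀ t < T, R.rew t ω ∈ Set.Icc (0 : ℝ) 1) (hg : ∀ t < T, ∀ s a, |R.g t ω s a| ≤ σ) :
    stepβ S A M.γ c σ T * ∑ t ∈ Finset.range T, ip (R.supergrad t ω) (k - R.lam t ω) ≤
      (1 - M.γ)⁻¹ * Real.log (numSA S A) + stepβ S A M.γ c σ T ^ 2 / 2 *
        ∑ t ∈ Finset.range T, (256 * ((1 + c * σ) / (1 - M.γ)) ^ 2 / (1 - M.γ) *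
          (zeta M.γ δ (R.lam t ω) (R.st t ω) (R.act t ω))⁻¹ + 8 * (c * σ) ^ 2 / (1 - M.γ)) := by
  have hγ1 : 0 < 1 - M.γ := by linarith [M.γ_lt_one]
  set β := stepβ S A M.γ c σ T
  have hβ : 0 < β := stepβ_pos M.γ_lt_one hcσ hn hT
  set Φ : ℕ → ℝ := fun t => ∑ s, ∑ a, k s a * Real.log (R.lam t ω s a)
  have hstep : ∀ t ∈ Finset.range T, β * ip (R.supergrad t ω) (k - R.lam t ω) ≤
      (Φ (t + 1) - Φ t) + β ^ 2 / 2 * (256 * ((1 + c * σ) / (1 - M.γ)) ^ 2 / (1 - M.γ) *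
        (zeta M.γ δ (R.lam t ω) (R.st t ω) (R.act t ω))⁻¹ + 8 * (c * σ) ^ 2 / (1 - M.γ)) := by
    intro t ht
    have htT := Finset.mem_range.1 ht
    have hmem := R.lam_mem hcσ hn htT.le ω
    have h1 := (R.lam_step t htT ω).regret M.γ_lt_one hβ (R.lam_pos hcσ hn htT.le ω) hmem
      (gradLam_nonpos M.γ_pos.le M.γ_lt_one hδ hc hcσ hmem.1 (R.v_mem htT.le ω) (hrew t htT)
        (hg t htT) _ _ _) hk
    have h2 := mul_le_mul_of_nonneg_left (sum_mul_sq_gradLam_le M.γ_pos.le M.γ_lt_one hδ hc hcσ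
      hmem (R.v_mem htT.le ω) (hrew t htT) (hg t htT) (R.st t ω) (R.act t ω) (R.nxt t ω))
      (by positivity : 0 ≤ β ^ 2 / 2)
    exact h1.trans (add_le_add le_rfl h2)
  have hsum := Finset.sum_le_sum hstep
  rw [Finset.sum_add_distrib, Finset.sum_range_sub, ← Finset.mul_sum, ← Finset.mul_sum] at hsum
  refine hsum.trans (add_le_add ?_ le_rfl)
  rw [← sum_of_mem_dualSet hk]
  simp only [Φ, ← Finset.sum_sub_distrib, Finset.sum_mul]
  refine Finset.sum_le_sum fun s _ => Finset.sum_le_sum fun a _ => ?_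
  rw [← mul_sub]
  refine mul_le_mul_of_nonneg_left ?_ (hk.1 s a)
  have hpos := R.lam_pos hcσ hn le_rfl ω s a
  have hle : R.lam T ω s a ≤ (1 - M.γ)⁻¹ := by
    rw [← (R.lam_mem hcσ hn le_rfl ω).2]
    exact (le_abs_self _).trans (abs_le_norm1 _ s a)
  have h3 := Real.log_le_log hpos hle
  have hn0 : 0 < numSA S A := by linarith
  rw [Real.log_inv] at h3
  rw [R.lam_init, one_div, Real.log_inv, Real.log_mul hn0.ne' hγ1.ne']
  linarith

/-- The bound is pathwise, so `z` may depend on `ω`. Coordinates of the box differ by at most 4B,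
which gives the 16. -/
lemma primal_regret_le (R : Run M c σ δ D ρ T μ) (hcσ : 0 ≤ c * σ)
    (hn : 1 < numSA S A) (hδ : δ ∈ Set.Ioo (0 : ℝ) (1 / 2)) (ω : Ω) {z : S → ℝ}
    (hz : z ∈ primalSet S M.γ c σ) :
    2 * stepα S c σ T * ∑ t ∈ Finset.range T, ∑ x, (R.v t ω x - z x) * R.grad t ω x ≤
      16 * ((1 + c * σ) / (1 - M.γ)) ^ 2 * Fintype.card S
        + stepα S c σ T ^ 2 * (T * (5 / (1 - M.γ)) ^ 2) := by
  set α := stepα S c σ T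
  have hstep : ∀ t ∈ Finset.range T, 2 * α * ∑ x, (R.v t ω x - z x) * R.grad t ω x ≤
      (-∑ x, (R.v (t + 1) ω x - z x) ^ 2 - -∑ x, (R.v t ω x - z x) ^ 2)
        + α ^ 2 * (5 / (1 - M.γ)) ^ 2 := by
    intro t ht
    have htT := Finset.mem_range.1 ht
    have h1 := (R.v_step t htT ω).regret (convex_primalSet S M.γ c σ) hz
    have h2 : ∑ x, R.grad t ω x ^ 2 ≤ (5 / (1 - M.γ)) ^ 2 :=
      (sum_sq_le_sq_sum_abs _).trans (pow_le_pow_left₀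
        (Finset.sum_nonneg fun _ _ => abs_nonneg _) (R.sum_abs_grad_le hcσ hn hδ htT.le ω) 2)
    have h3 := mul_le_mul_of_nonneg_left h2 (sq_nonneg α)
    have h4 : 2 * α * ∑ x, (R.v t ω x - z x) * R.grad t ω x ≤
        ∑ x, (R.v t ω x - z x) ^ 2 - ∑ x, (R.v (t + 1) ω x - z x) ^ 2
          + α ^ 2 * ∑ x, R.grad t ω x ^ 2 := h1
    linarith
  have hsum := Finset.sum_le_sum hstep
  rw [Finset.sum_add_distrib, Finset.sum_range_sub (fun t => -∑ x, (R.v t ω x - z x) ^ 2),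
    ← Finset.mul_sum, Finset.sum_const, Finset.card_range, nsmul_eq_mul] at hsum
  have h0 : ∑ x, (R.v 0 ω x - z x) ^ 2 ≤
      16 * ((1 + c * σ) / (1 - M.γ)) ^ 2 * Fintype.card S := by
    refine (Finset.sum_le_card_nsmul _ _ (16 * ((1 + c * σ) / (1 - M.γ)) ^ 2) fun x _ => ?_).trans
      (by simp [mul_comm])
    have h1 := abs_le.1 (R.v_init ω x)
    have h2 := abs_le.1 (hz x)
    have := sq_le_sq' (by linarith : -(4 * ((1 + c * σ) / (1 - M.γ))) ≤ R.v 0 ω x - z x)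
      (by linarith)
    refine this.trans (le_of_eq ?_)
    ring
  have hT0 : 0 ≤ ∑ x, (R.v T ω x - z x) ^ 2 := Finset.sum_nonneg fun _ _ => sq_nonneg _
  linarith

/-- Young's inequality, from expanding ∑(z + αX)² ≥ 0. It decouples the run-dependent comparator
from the accumulated noise. -/
lemma neg_sum_mul_le {z X : S → ℝ} {b α : ℝ} (hz : ∀ s, |z s| ≤ b) :
    2 * α * -∑ x, z x * X x ≤ b ^ 2 * Fintype.card S + α ^ 2 * ∑ x, X x ^ 2 := by
  have h1 : ∑ x, z x ^ 2 ≤ b ^ 2 * Fintype.card S := by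
    refine (Finset.sum_le_card_nsmul _ _ (b ^ 2) fun x _ => ?_).trans (by simp [mul_comm])
    exact sq_le_sq' (abs_le.1 (hz x)).1 (abs_le.1 (hz x)).2
  have h2 : 0 ≤ ∑ x, (z x + α * X x) ^ 2 := Finset.sum_nonneg fun _ _ => sq_nonneg _
  have h3 : ∑ x, (z x + α * X x) ^ 2 = ∑ x, z x ^ 2 + 2 * α * ∑ x, z x * X x
      + α ^ 2 * ∑ x, X x ^ 2 := by
    simp only [Finset.mul_sum, ← Finset.sum_add_distrib]
    exact Finset.sum_congr rfl fun x _ => by ring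
  linarith

lemma mul_avg (R : Run M c σ δ D ρ T μ) (hT : 0 < T) (ω : Ω) (s : S) (a : A) :
    T * R.avg ω s a = ∑ t ∈ Finset.range T, R.lam t ω s a := by
  have hT' : (T : ℝ) ≠ 0 := by exact_mod_cast hT.ne'
  rw [Run.avg, ← mul_assoc, mul_one_div_cancel hT', one_mul]

lemma mul_flowResidual_avg (R : Run M c σ δ D ρ T μ) (hT : 0 < T) (ω : Ω) (s : S) :
    T * M.flowResidual (R.avg ω) s = ∑ t ∈ Finset.range T, M.flowResidual (R.lam t ω) s := by
  simp only [MDP.flowResidual, Finset.sum_sub_distrib, mul_sub, Finset.sum_const,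
    Finset.card_range, nsmul_eq_mul]
  congr 1
  congr 1
  · rw [Finset.mul_sum, Finset.sum_comm]
    simp only [R.mul_avg hT]
  · have h : ∀ a i, (T : ℝ) * (M.γ * (M.P a i s * R.avg ω i a)) =
        ∑ t ∈ Finset.range T, M.γ * (M.P a i s * R.lam t ω i a) := fun a i => by
      rw [← Finset.mul_sum, ← Finset.mul_sum, ← R.mul_avg hT]
      ring
    simp only [Finset.mul_sum, h]
    rw [Finset.sum_comm (s := Finset.range T)]
    exact Finset.sum_congr rfl fun a _ => Finset.sum_comm

lemma mul_ip_avg (R : Run M c σ δ D ρ T μ) (hT : 0 < T) (ω : Ω) (u : S → A → ℝ) :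
    T * ip u (R.avg ω) = ∑ t ∈ Finset.range T, ip u (R.lam t ω) := by
  simp only [ip, Finset.mul_sum]
  rw [Finset.sum_comm (s := Finset.range T)]
  refine Finset.sum_congr rfl fun s _ => ?_
  rw [Finset.sum_comm (s := Finset.range T)]
  refine Finset.sum_congr rfl fun a _ => ?_
  rw [← Finset.mul_sum, ← R.mul_avg hT]
  ring

/-- Jensen's inequality for the cautious objective. -/
lemma sum_objective_le (R : Run M c σ δ D ρ T μ) (hρ : IsCaution M.γ D ρ σ) (hc : 0 ≤ c)
    (hcσ : 0 ≤ c * σ) (hn : 1 < numSA S A) (hT : 0 < T) (ω : Ω) :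
    ∑ t ∈ Finset.range T, M.objective c ρ (R.lam t ω) ≤ T * M.objective c ρ (R.avg ω) := by
  obtain ⟨u, hu⟩ := hρ.nonempty _ (R.avg_mem hcσ hn hT ω)
  have h1 : ∀ t ∈ Finset.range T, M.objective c ρ (R.lam t ω) ≤
      ip M.r (R.lam t ω) - c * (ρ (R.avg ω) + (ip u (R.lam t ω) - ip u (R.avg ω))) := by
    intro t ht
    have h2 := hu _ (hρ.dom (R.lam_mem hcσ hn (Finset.mem_range.1 ht).le ω))
    rw [ip_sub_right] at h2
    rw [MDP.objective, ip_comm]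
    exact sub_le_sub_left (mul_le_mul_of_nonneg_left h2 hc) _
  refine (Finset.sum_le_sum h1).trans (le_of_eq ?_)
  rw [Finset.sum_sub_distrib, ← Finset.mul_sum, Finset.sum_add_distrib, Finset.sum_sub_distrib,
    ← R.mul_ip_avg hT, ← R.mul_ip_avg hT, MDP.objective, ip_comm (R.avg ω)]
  simp only [Finset.sum_const, Finset.card_range, nsmul_eq_mul]
  ring

/-- Concavity of the Lagrangian in λ: the left side is L(v, k) - L(v, λ), since the residual of the
feasible `k` is zero. -/
lemma objective_sub_add_le (R : Run M c σ δ D ρ T μ) (hρ : IsCaution M.γ D ρ σ) (hc : 0 ≤ c)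
    {t : ℕ} {k : S → A → ℝ} (hk : k ∈ M.feasible)
    {ω : Ω} (hu : R.meanSubgrad t ω ∈ subdiff D ρ (R.lam t ω)) :
    M.objective c ρ k - M.objective c ρ (R.lam t ω)
        + ∑ s, R.v t ω s * M.flowResidual (R.lam t ω) s ≤
      ip (fun s a => M.r s a + (M.γ * ∑ s', M.P a s s' * R.v t ω s' - R.v t ω s))
        (k - R.lam t ω) - c * ip (R.meanSubgrad t ω) (k - R.lam t ω) := by
  have h1 := mul_le_mul_of_nonneg_left (hu k (hρ.dom hk.1)) hc
  have h2 : ip (fun s a => M.r s a + (M.γ * ∑ s', M.P a s s' * R.v t ω s' - R.v t ω s))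
      (k - R.lam t ω) = ip M.r (k - R.lam t ω) +
      ip (fun s a => M.γ * ∑ s', M.P a s s' * R.v t ω s' - R.v t ω s) (k - R.lam t ω) :=
    ip_add_left M.r _ _
  have h3 := M.sum_mul_flowResidual (lam := R.lam t ω) hk (R.v t ω)
  have h4 : ip (fun s a => M.γ * ∑ s', M.P a s s' * R.v t ω s' - R.v t ω s) (k - R.lam t ω) =
      ∑ s, R.v t ω s * M.flowResidual (R.lam t ω) s := by
    rw [h3]
    exact Finset.sum_congr rfl fun s _ => Finset.sum_congr rfl fun a _ => mul_comm _ _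
  rw [h2, h4, MDP.objective, MDP.objective, ip_comm k, ip_comm (R.lam t ω),
    ip_sub_right M.r]
  linarith

/-- The duality gap of a run is at most its primal and dual regrets and the noise. -/
lemma gap_le (R : Run M c σ δ D ρ T μ) (hρ : IsCaution M.γ D ρ σ) (hc : 0 ≤ c)
    (hcσ : 0 ≤ c * σ) (hn : 1 < numSA S A) (hδ : δ ∈ Set.Ioo (0 : ℝ) (1 / 2)) (hT : 0 < T)
    {k : S → A → ℝ} (hk : k ∈ M.feasible) {ω : Ω}
    (hu : ∀ t < T, R.meanSubgrad t ω ∈ subdiff D ρ (R.lam t ω)) :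
    T * (M.objective c ρ k - M.objective c ρ (R.avg ω)
        + 2 * ((1 + c * σ) / (1 - M.γ)) * M.violation (R.avg ω)) ≤
      ∑ t ∈ Finset.range T,
        (ip (fun s a => M.r s a + (M.γ * ∑ s', M.P a s s' * R.v t ω s' - R.v t ω s))
          (k - R.lam t ω) - c * ip (R.meanSubgrad t ω) (k - R.lam t ω))
      + ∑ t ∈ Finset.range T, ∑ x, R.v t ω x * R.noise t ω x
      + (2 * stepα S c σ T)⁻¹ * (20 * ((1 + c * σ) / (1 - M.γ)) ^ 2 * Fintype.card S
        + stepα S c σ T ^ 2 * (T * (5 / (1 - M.γ)) ^ 2)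
        + stepα S c σ T ^ 2 * ∑ x, (∑ t ∈ Finset.range T, R.noise t ω x) ^ 2) := by
  have hα : 0 < stepα S c σ T := stepα_pos hcσ hT
  have hγ1 : 0 < 1 - M.γ := by linarith [M.γ_lt_one]
  set B := (1 + c * σ) / (1 - M.γ)
  have hB0 : 0 ≤ B := by positivity
  -- The vertex of the box that turns the Lagrangian pairing into 2B times the ℓ¹ violation of the
  -- average.
  set z : S → ℝ := fun s => if 0 ≤ M.flowResidual (R.avg ω) s then 2 * B else -(2 * B) with hz
  have hzabs : ∀ s, |z s| ≤ 2 * B := fun s => by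
    simp only [hz]
    split_ifs
    · rw [abs_of_nonneg (by positivity)]
    · rw [abs_neg, abs_of_nonneg (by positivity)]
  have hzmul : 2 * B * M.violation (R.avg ω) = ∑ s, z s * M.flowResidual (R.avg ω) s := by
    rw [MDP.violation, Finset.mul_sum]
    refine Finset.sum_congr rfl fun s _ => ?_
    simp only [hz]
    split_ifs with h
    · rw [abs_of_nonneg h]
    · rw [abs_of_neg (not_le.1 h)]
      ring
  have h1 := R.primal_regret_le hcσ hn hδ ω (z := z) hzabs
  have h2 := neg_sum_mul_le (α := stepα S c σ T)
    (X := fun x => ∑ t ∈ Finset.range T, R.noise t ω x) hzabs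
  have h3 := R.sum_objective_le hρ hc hcσ hn hT ω
  have h4 := Finset.sum_le_sum fun t (ht : t ∈ Finset.range T) =>
    R.objective_sub_add_le hρ hc hk (hu t (Finset.mem_range.1 ht))
  rw [Finset.sum_add_distrib, Finset.sum_sub_distrib, Finset.sum_const, Finset.card_range,
    nsmul_eq_mul] at h4
  have h5 : T * (2 * B * M.violation (R.avg ω)) =
      ∑ t ∈ Finset.range T, ∑ x, (R.v t ω x - z x) * R.grad t ω x
      + -∑ x, z x * ∑ t ∈ Finset.range T, R.noise t ω x
      + ∑ t ∈ Finset.range T, ∑ s, R.v t ω s * M.flowResidual (R.lam t ω) s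
      + ∑ t ∈ Finset.range T, ∑ x, R.v t ω x * R.noise t ω x := by
    -- Substituting res = -(grad + noise) and z = v - (v - z) separates the primal regret, the
    -- centred noise against v, and the uncentred noise against z.
    have h6 : ∑ x, z x * ∑ t ∈ Finset.range T, R.noise t ω x =
        ∑ t ∈ Finset.range T, ∑ x, z x * R.noise t ω x := by
      simp only [Finset.mul_sum]
      exact Finset.sum_comm
    have h7 : T * ∑ s, z s * M.flowResidual (R.avg ω) s =
        ∑ t ∈ Finset.range T, ∑ x, z x * M.flowResidual (R.lam t ω) x := by
      rw [Finset.sum_comm, Finset.mul_sum]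
      refine Finset.sum_congr rfl fun s _ => ?_
      rw [← Finset.mul_sum, ← R.mul_flowResidual_avg hT]
      ring
    rw [hzmul, h7, h6]
    simp only [← Finset.sum_neg_distrib, ← Finset.sum_add_distrib]
    refine Finset.sum_congr rfl fun t _ => Finset.sum_congr rfl fun x _ => ?_
    rw [noise]
    ring
  -- Here 20 = 16 + 4: the primal regret plus (2B)² from Young's inequality.
  have h8 : ∑ t ∈ Finset.range T, ∑ x, (R.v t ω x - z x) * R.grad t ω x
      + -∑ x, z x * ∑ t ∈ Finset.range T, R.noise t ω x ≤
      (2 * stepα S c σ T)⁻¹ * (20 * B ^ 2 * Fintype.card S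
        + stepα S c σ T ^ 2 * (T * (5 / (1 - M.γ)) ^ 2)
        + stepα S c σ T ^ 2 * ∑ x, (∑ t ∈ Finset.range T, R.noise t ω x) ^ 2) := by
    rw [← div_eq_inv_mul, le_div_iff₀' (by positivity), mul_add]
    have : (2 * B) ^ 2 = 4 * B ^ 2 := by ring
    rw [this] at h2
    linarith
  rw [mul_add, h5, mul_sub]
  linarith

end Run

end Regret

/-! ### From regret to the expected gap. -/

section Rate

variable {S A : Type*} [Fintype S] [Fintype A]

/-! ### The step sizes balance the regret -/

lemma stepβ_eq {γ c σ : ℝ} {T : ℕ} (hn : 1 < numSA S A) (hT : 0 < T) :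
    stepβ S A γ c σ T = √(T * numSA S A * Real.log (numSA S A)) /
      ((1 + c * σ) / (1 - γ) * (T * numSA S A)) := by
  have hT' : (0 : ℝ) < T := by exact_mod_cast hT
  have hn0 : 0 < numSA S A := by linarith
  have hL := Real.log_pos hn
  have h : √(Real.log (numSA S A) / (T * numSA S A)) =
      √(T * numSA S A * Real.log (numSA S A)) / (T * numSA S A) := by
    rw [Real.sqrt_eq_iff_mul_self_eq (by positivity) (by positivity), div_mul_div_comm,
      Real.mul_self_sqrt (by positivity)]
    field_simp
  rw [stepβ, h, ← inv_div (1 + c * σ) (1 - γ), inv_mul_eq_div, div_div,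
    mul_comm (T * numSA S A) ((1 + c * σ) / (1 - γ))]

lemma stepα_eq {c σ : ℝ} {T : ℕ} (hT : 0 < T) :
    stepα S c σ T = √(Fintype.card S * T) / T * (1 + c * σ) := by
  have hT' : (0 : ℝ) < T := by exact_mod_cast hT
  have h : √((Fintype.card S : ℝ) / T) = √(Fintype.card S * T) / T := by
    rw [Real.sqrt_eq_iff_mul_self_eq (by positivity) (by positivity), div_mul_div_comm,
      Real.mul_self_sqrt (by positivity)]
    field_simp
  rw [stepα, h]

/-- Two state-action pairs already give log n ≥ log 2 ≥ 1/4, so the primal rate is absorbed by the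
dual one. -/
lemma sqrt_card_mul_le [Nonempty A] {T : ℕ} (hcard : 2 ≤ numSA S A) :
    √(Fintype.card S * T) ≤ 2 * √(T * numSA S A * Real.log (numSA S A)) := by
  have hL : 1 / 4 ≤ Real.log (numSA S A) := by
    have h1 := Real.log_le_log (by norm_num) hcard
    linarith [Real.log_two_gt_d9]
  have hS : (Fintype.card S : ℝ) ≤ numSA S A := by
    have hA : (1 : ℝ) ≤ Fintype.card A := by exact_mod_cast Fintype.card_pos
    exact le_mul_of_one_le_right (by positivity) hA
  have h4 : (2 : ℝ) = √4 := by
    rw [show (4 : ℝ) = 2 ^ 2 by norm_num, Real.sqrt_sq (by norm_num)]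
  rw [h4, ← Real.sqrt_mul (by norm_num)]
  apply Real.sqrt_le_sqrt
  have hT : (0 : ℝ) ≤ T := by positivity
  have h2 : (Fintype.card S : ℝ) * T ≤ numSA S A * T := mul_le_mul_of_nonneg_right hS hT
  have h3 : T * numSA S A * (1 / 4) ≤ T * numSA S A * Real.log (numSA S A) :=
    mul_le_mul_of_nonneg_left hL (by positivity)
  linarith

/-- The constant is 133 = 1 + 264/2: the entropy term contributes 1, and the second moment, with
(cσ)² absorbed into B²n, contributes (256 + 8)/2. -/
lemma dual_rate {γ c σ : ℝ} {T : ℕ} (hγ : γ < 1) (hγ0 : 0 < γ) (hcσ : 0 ≤ c * σ)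
    (hn : 1 < numSA S A) (hT : 0 < T) :
    (stepβ S A γ c σ T)⁻¹ * ((1 - γ)⁻¹ * Real.log (numSA S A) + stepβ S A γ c σ T ^ 2 / 2 *
      (T * (256 * ((1 + c * σ) / (1 - γ)) ^ 2 / (1 - γ) * numSA S A
        + 8 * (c * σ) ^ 2 / (1 - γ)))) ≤
      133 * (1 + c * σ) / (1 - γ) ^ 2 * √(T * numSA S A * Real.log (numSA S A)) := by
  have hT' : (0 : ℝ) < T := by exact_mod_cast hT
  have hL := Real.log_pos hn
  have hg : 0 < 1 - γ := by linarith
  have hβ := stepβ_pos (S := S) (A := A) hγ hcσ hn hT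
  have hC : 1 ≤ (1 + c * σ) / (1 - γ) := by
    rw [le_div_iff₀ hg]
    linarith
  have hσ2 : (c * σ) ^ 2 ≤ ((1 + c * σ) / (1 - γ)) ^ 2 * numSA S A := by
    have h1 : c * σ ≤ (1 + c * σ) / (1 - γ) := by
      rw [le_div_iff₀ hg]
      nlinarith
    have h2 := pow_le_pow_left₀ hcσ h1 2
    exact h2.trans (le_mul_of_one_le_right (by positivity) hn.le)
  have hXsq := Real.sq_sqrt (by positivity : 0 ≤ T * numSA S A * Real.log (numSA S A))
  have hX : 0 < √(T * numSA S A * Real.log (numSA S A)) := Real.sqrt_pos.2 (by positivity)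
  have hβeq := stepβ_eq (γ := γ) (c := c) (σ := σ) hn hT
  set β := stepβ S A γ c σ T
  set X := √(T * numSA S A * Real.log (numSA S A))
  set n := numSA S A
  set L := Real.log n
  have hB : 133 * (1 + c * σ) / (1 - γ) ^ 2 = 133 * ((1 + c * σ) / (1 - γ)) / (1 - γ) := by
    field_simp
  rw [hB]
  set B := (1 + c * σ) / (1 - γ)
  have hn0 : 0 < n := by linarith
  have hB0 : 0 < B := by linarith
  have h1 : 256 * B ^ 2 / (1 - γ) * n + 8 * (c * σ) ^ 2 / (1 - γ) ≤
      264 * B ^ 2 * n / (1 - γ) := by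
    have h2 := mul_le_mul_of_nonneg_left hσ2 (by positivity : 0 ≤ 8 / (1 - γ))
    have h3 : 264 * B ^ 2 * n / (1 - γ) =
        256 * B ^ 2 / (1 - γ) * n + 8 / (1 - γ) * (B ^ 2 * n) := by ring
    rw [h3]
    refine add_le_add le_rfl (le_trans (le_of_eq ?_) h2)
    ring
  calc β⁻¹ * ((1 - γ)⁻¹ * L + β ^ 2 / 2 *
        (T * (256 * B ^ 2 / (1 - γ) * n + 8 * (c * σ) ^ 2 / (1 - γ))))
      ≤ β⁻¹ * ((1 - γ)⁻¹ * L + β ^ 2 / 2 * (T * (264 * B ^ 2 * n / (1 - γ)))) := by gcongr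
    _ = (B * (T * n * L / X) + 132 * (β * (B * (T * n))) * B) / (1 - γ) := by
        have : β⁻¹ = B * (T * n) / X := by rw [hβeq, inv_div]
        have h5 : β⁻¹ * β = 1 := inv_mul_cancel₀ hβ.ne'
        have h6 : β⁻¹ * ((1 - γ)⁻¹ * L + β ^ 2 / 2 * (T * (264 * B ^ 2 * n / (1 - γ)))) =
            (β⁻¹ * L + (β⁻¹ * β) * (132 * (β * (B * (T * n))) * B)) / (1 - γ) := by ring
        rw [h6, h5, this]
        ring
    _ = 133 * B / (1 - γ) * X := by
        have h5 : T * n * L / X = X := by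
          rw [← hXsq]
          field_simp
        have h6 : β * (B * (T * n)) = X := by
          rw [hβeq]
          field_simp
        rw [h5, h6]
        ring

lemma primal_rate [Nonempty S] [Nonempty A] {γ c σ : ℝ} {T : ℕ} (hγ : γ < 1)
    (hcσ : 0 ≤ c * σ) (hcard : 2 ≤ numSA S A) (hT : 0 < T) :
    (2 * stepα S c σ T)⁻¹ * (20 * ((1 + c * σ) / (1 - γ)) ^ 2 * Fintype.card S
        + stepα S c σ T ^ 2 * (T * (5 / (1 - γ)) ^ 2)
        + stepα S c σ T ^ 2 * (T * (8 / (1 - γ)) ^ 2)) ≤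
      110 * (1 + c * σ) / (1 - γ) ^ 2 * √(T * numSA S A * Real.log (numSA S A)) := by
  have hT' : (0 : ℝ) < T := by exact_mod_cast hT
  have hg : 0 < 1 - γ := by linarith
  have hS : (0 : ℝ) < Fintype.card S := by exact_mod_cast Fintype.card_pos
  have hY := sqrt_card_mul_le (S := S) (A := A) (T := T) hcard
  have hYsq := Real.sq_sqrt (by positivity : 0 ≤ (Fintype.card S : ℝ) * T)
  have hY0 : 0 < √((Fintype.card S : ℝ) * T) := Real.sqrt_pos.2 (by positivity)
  rw [stepα_eq hT]
  set Y := √((Fintype.card S : ℝ) * T)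
  set X := √(T * numSA S A * Real.log (numSA S A))
  set C := 1 + c * σ
  have hC : 0 < C := by positivity
  have hcardS : (Fintype.card S : ℝ) = Y ^ 2 / T := by
    rw [hYsq]
    field_simp
  -- 54.5 = (20 + 5² + 8²)/2.
  calc _ = 54.5 * C / (1 - γ) ^ 2 * Y := by
        rw [hcardS]
        field_simp
        ring
    _ ≤ 54.5 * C / (1 - γ) ^ 2 * (2 * X) := by gcongr
    _ ≤ 110 * C / (1 - γ) ^ 2 * X := by
        have hX : 0 ≤ C / (1 - γ) ^ 2 * X := by positivity
        have h1 : 54.5 * C / (1 - γ) ^ 2 * (2 * X) = 109 * (C / (1 - γ) ^ 2 * X) := by ring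
        have h2 : 110 * C / (1 - γ) ^ 2 * X = 110 * (C / (1 - γ) ^ 2 * X) := by ring
        rw [h1, h2]
        linarith

variable [DecidableEq S] [DecidableEq A]
  {M : MDP S A} {c σ δ : ℝ} {D : Set (S → A → ℝ)} {ρ : (S → A → ℝ) → ℝ} {T : ℕ}
  {Ω : Type*} [mΩ : MeasurableSpace Ω] {μ : Measure Ω} [Nonempty S] [Nonempty A]

namespace Run

lemma measurable_avg (R : Run M c σ δ D ρ T μ) : Measurable R.avg :=
  measurable_pi_iff.2 fun s => measurable_pi_iff.2 fun a =>
    (Finset.measurable_fun_sum _ fun t ht =>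
      (R.measurable_lam (Finset.mem_range.1 ht).le s a).mono (R.ℱ.le t) le_rfl).const_mul _

variable [IsProbabilityMeasure μ]

lemma integrable_violation (R : Run M c σ δ D ρ T μ) (hcσ : 0 ≤ c * σ) (hn : 1 < numSA S A)
    (hT : 0 < T) : Integrable (fun ω => M.violation (R.avg ω)) μ := by
  refine Integrable.of_bound (C := 3 / (1 - M.γ)) ?_ (Filter.Eventually.of_forall fun ω => ?_)
  · have hm : Measurable fun lam : S → A → ℝ => M.violation lam := by
      unfold MDP.violation MDP.flowResidual
      fun_prop
    exact (hm.comp R.measurable_avg).aestronglyMeasurable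
  · rw [Real.norm_eq_abs, MDP.violation, abs_of_nonneg (Finset.sum_nonneg fun _ _ => abs_nonneg _)]
    exact M.sum_abs_flowResidual_le (R.avg_mem hcσ hn hT ω)

/-- The Lipschitz bound makes the gap bounded on the dual set, and continuity of `ρ` there gives
measurability. -/
lemma integrable_objective_gap (R : Run M c σ δ D ρ T μ) (hρ : IsCaution M.γ D ρ σ) (hc : 0 ≤ c)
    (hcσ : 0 ≤ c * σ) (hn : 1 < numSA S A) (hT : 0 < T) {k : S → A → ℝ}
    (hk : k ∈ dualSet S A M.γ) :
    Integrable (fun ω => M.objective c ρ k - M.objective c ρ (R.avg ω)) μ := by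
  have hmem := R.avg_mem hcσ hn hT
  refine Integrable.of_bound (C := (1 + c * σ) * (2 * (1 - M.γ)⁻¹)) ?_
    (Filter.Eventually.of_forall fun ω => ?_)
  · have h1 : Measurable fun ω => ρ (R.avg ω) := by
      have h2 : Measurable fun ω => (⟨R.avg ω, hmem ω⟩ : dualSet S A M.γ) :=
        R.measurable_avg.subtype_mk
      exact (continuousOn_iff_continuous_domRestrict.1 hρ.continuousOn).measurable.comp h2
    have h3 : Measurable fun lam : S → A → ℝ => ip lam M.r := by
      unfold ip
      fun_prop
    exact (((h3.comp R.measurable_avg).sub (h1.const_mul c)).const_sub _).aestronglyMeasurable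
  · rw [Real.norm_eq_abs, abs_sub_le_iff]
    have hC : 0 ≤ 1 + c * σ := by linarith
    exact ⟨(M.objective_sub_le hc hρ hk (hmem ω)).trans
      (mul_le_mul_of_nonneg_left (norm1_sub_le hk (hmem ω)) hC),
      (M.objective_sub_le hc hρ (hmem ω) hk).trans
      (mul_le_mul_of_nonneg_left (norm1_sub_le (hmem ω) hk) hC)⟩

lemma integral_dual_regret_le (R : Run M c σ δ D ρ T μ) (hc : 0 ≤ c) (hcσ : 0 ≤ c * σ)
    (hn : 1 < numSA S A) (hδ : δ ∈ Set.Ioo (0 : ℝ) (1 / 2)) (hT : 0 < T) {k : S → A → ℝ}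
    (hk : k ∈ dualSet S A M.γ) :
    ∫ ω, ∑ t ∈ Finset.range T, ip (R.supergrad t ω) (k - R.lam t ω) ∂μ ≤
      133 * (1 + c * σ) / (1 - M.γ) ^ 2 * √(T * numSA S A * Real.log (numSA S A)) := by
  refine le_trans ?_ (dual_rate M.γ_lt_one M.γ_pos hcσ hn hT)
  have hβ := stepβ_pos (S := S) (A := A) M.γ_lt_one hcσ hn hT
  set β := stepβ S A M.γ c σ T
  set b₁ := 256 * ((1 + c * σ) / (1 - M.γ)) ^ 2 / (1 - M.γ)
  set b₂ := 8 * (c * σ) ^ 2 / (1 - M.γ)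
  have hI : ∀ t ∈ Finset.range T, Integrable (fun ω => b₁ *
      (zeta M.γ δ (R.lam t ω) (R.st t ω) (R.act t ω))⁻¹ + b₂) μ := fun t ht =>
    ((R.integral_inv_zeta hcσ hn hδ (Finset.mem_range.1 ht)).1.const_mul b₁).add
      (integrable_const _)
  have hIval : ∀ t ∈ Finset.range T, ∫ ω, (b₁ *
      (zeta M.γ δ (R.lam t ω) (R.st t ω) (R.act t ω))⁻¹ + b₂) ∂μ = b₁ * numSA S A + b₂ :=
    fun t ht => by
      have h := R.integral_inv_zeta hcσ hn hδ (Finset.mem_range.1 ht)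
      rw [integral_add (h.1.const_mul b₁) (integrable_const _), integral_const_mul, h.2]
      simp
  have hL : Integrable (fun ω => ∑ t ∈ Finset.range T,
      ip (R.supergrad t ω) (k - R.lam t ω)) μ := integrable_finsetSum _ fun t ht =>
    (R.integral_ip_supergrad hcσ hn hδ (Finset.mem_range.1 ht) hk).1
  have hU : Integrable (fun ω => ∑ t ∈ Finset.range T, (b₁ *
      (zeta M.γ δ (R.lam t ω) (R.st t ω) (R.act t ω))⁻¹ + b₂)) μ := integrable_finsetSum _ hI
  have hU2 := (integrable_const (μ := μ) ((1 - M.γ)⁻¹ * Real.log (numSA S A))).add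
    (hU.const_mul (β ^ 2 / 2))
  have hmono := integral_mono_ae (hL.const_mul β) hU2 (by
    filter_upwards [ae_all_iff.2 fun t : ℕ => ae_all_iff.2 fun ht : t < T => R.rew_mem ht,
      ae_all_iff.2 fun t : ℕ => ae_all_iff.2 fun ht : t < T => R.g_bound t ht] with ω h1 h2
    exact R.dual_regret_le hc hcσ hn hδ hT hk h1 h2)
  rw [integral_const_mul, integral_add' (integrable_const _) (hU.const_mul (β ^ 2 / 2)),
    integral_const_mul (β ^ 2 / 2), integral_finsetSum _ hI, Finset.sum_congr rfl hIval] at hmono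
  simp only [integral_const, probReal_univ, one_smul, Finset.sum_const, Finset.card_range,
    nsmul_eq_mul] at hmono
  rwa [← div_eq_inv_mul, le_div_iff₀' hβ]

/-- The expected duality gap of the averaged output. -/
lemma integral_gap_le (R : Run M c σ δ D ρ T μ) (hρ : IsCaution M.γ D ρ σ) (hc : 0 ≤ c)
    (hcσ : 0 ≤ c * σ) (hcard : 2 ≤ numSA S A) (hδ : δ ∈ Set.Ioo (0 : ℝ) (1 / 2)) (hT : 0 < T)
    {k : S → A → ℝ} (hk : k ∈ M.feasible) :
    T * (∫ ω, (M.objective c ρ k - M.objective c ρ (R.avg ω)) ∂μ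
      + 2 * ((1 + c * σ) / (1 - M.γ)) * ∫ ω, M.violation (R.avg ω) ∂μ) ≤
      243 * (1 + c * σ) / (1 - M.γ) ^ 2 * √(T * numSA S A * Real.log (numSA S A)) := by
  have hn : 1 < numSA S A := by linarith
  have hα : 0 < stepα S c σ T := stepα_pos hcσ hT
  have hG := R.integrable_objective_gap hρ hc hcσ hn hT hk.1
  have hV := R.integrable_violation hcσ hn hT
  set B := (1 + c * σ) / (1 - M.γ)
  set α := stepα S c σ T
  have hD := fun t (ht : t ∈ Finset.range T) =>
    R.integral_ip_supergrad hcσ hn hδ (Finset.mem_range.1 ht) hk.1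
  have hN := fun t (ht : t ∈ Finset.range T) =>
    R.integral_mul_noise hcσ hn hδ (Finset.mem_range.1 ht) (Y := R.v t)
      (fun x => R.measurable_v (Finset.mem_range.1 ht).le x)
      (fun ω x => R.v_mem (Finset.mem_range.1 ht).le ω x)
  have hS := R.integral_sq_sum_noise_le hcσ hn hδ le_rfl
  have hQ := integrable_finsetSum _ fun t ht => (hD t ht).2.1
  have hNI := integrable_finsetSum _ fun t ht => (hN t ht).1
  have hSI : Integrable (fun ω => 20 * B ^ 2 * Fintype.card S + α ^ 2 * (T * (5 / (1 - M.γ)) ^ 2)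
      + α ^ 2 * ∑ x, (∑ t ∈ Finset.range T, R.noise t ω x) ^ 2) μ :=
    (integrable_const _).add (hS.1.const_mul (α ^ 2))
  have hmono := integral_mono_ae
    (f := fun ω => T * (M.objective c ρ k - M.objective c ρ (R.avg ω)
        + 2 * B * M.violation (R.avg ω)))
    ((hG.add (hV.const_mul (2 * B))).const_mul (T : ℝ))
    ((hQ.add hNI).add (hSI.const_mul (2 * α)⁻¹)) (by
      filter_upwards [ae_all_iff.2 fun t : ℕ =>
        ae_all_iff.2 fun ht : t < T => R.g_unbiased t ht] with ω hu
      exact R.gap_le hρ hc hcσ hn hδ hT hk hu)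
  have hSval : ∫ ω, (20 * B ^ 2 * Fintype.card S + α ^ 2 * (T * (5 / (1 - M.γ)) ^ 2)
      + α ^ 2 * ∑ x, (∑ t ∈ Finset.range T, R.noise t ω x) ^ 2) ∂μ ≤
      20 * B ^ 2 * Fintype.card S + α ^ 2 * (T * (5 / (1 - M.γ)) ^ 2)
        + α ^ 2 * (T * (8 / (1 - M.γ)) ^ 2) := by
    rw [integral_add (integrable_const _) (hS.1.const_mul (α ^ 2)), integral_const_mul]
    simp only [integral_const, probReal_univ, one_smul]
    exact add_le_add le_rfl (mul_le_mul_of_nonneg_left hS.2 (sq_nonneg α))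
  have hrate := (mul_le_mul_of_nonneg_left hSval (by positivity : 0 ≤ (2 * α)⁻¹)).trans
    (primal_rate M.γ_lt_one hcσ hcard hT)
  have hLHS : ∫ ω, T * (M.objective c ρ k - M.objective c ρ (R.avg ω)
      + 2 * B * M.violation (R.avg ω)) ∂μ =
      T * (∫ ω, (M.objective c ρ k - M.objective c ρ (R.avg ω)) ∂μ
        + 2 * B * ∫ ω, M.violation (R.avg ω) ∂μ) := by
    rw [integral_const_mul, integral_add hG (hV.const_mul (2 * B)), integral_const_mul]
  have hdual := R.integral_dual_regret_le hc hcσ hn hδ hT hk.1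
  -- The dual regret is bounded for the sampled supergradients, whereas the gap involves their
  -- conditional means; unbiasedness exchanges the two in expectation.
  rw [integral_finsetSum _ fun t ht => (hD t ht).1,
    Finset.sum_congr rfl fun t ht => (hD t ht).2.2,
    ← integral_finsetSum _ fun t ht => (hD t ht).2.1] at hdual
  have hnoise := integral_finsetSum _ fun t ht => (hN t ht).1
  rw [Finset.sum_eq_zero fun t ht => (hN t ht).2] at hnoise
  have hRHS := integral_add_add_const_mul hQ hNI hSI (2 * α)⁻¹
  rw [hLHS] at hmono
  refine (hmono.trans (le_of_eq hRHS)).trans ?_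
  rw [hnoise, add_zero]
  refine (add_le_add hdual hrate).trans (le_of_eq ?_)
  ring

end Run

end Rate

end CautiousRL

/-! ### The sample-complexity theorem. -/

open CautiousRL in
theorem theorem2 : ∃ K : ℝ, 0 < K ∧
    ∀ (S A : Type*) [Fintype S] [Fintype A] [DecidableEq S] [DecidableEq A]
      (_hcard : 2 ≤ Fintype.card S * Fintype.card A)
      (M : MDP S A) (c σ δ ε : ℝ) (_hc : 0 < c) (_hδ : δ ∈ Set.Ioo (0 : ℝ) (1 / 2)) (_hε : 0 < ε)
      (D : Set (S → A → ℝ)) (ρ : (S → A → ℝ) → ℝ) (_hρ : IsCaution M.γ D ρ σ)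
      (T : ℕ)
      (_hT : K * (numSA S A * Real.log (numSA S A) * (1 + 2 * c * σ) ^ 2
        / ((1 - M.γ) ^ 4 * ε ^ 2)) ≤ (T : ℝ))
      (Ω : Type*) [MeasurableSpace Ω] (μ : Measure Ω) [IsProbabilityMeasure μ]
      (R : Run M c σ δ D ρ T μ),
      (∀ ω, (∀ s a, 0 ≤ R.avg ω s a) ∧ norm1 (R.avg ω) = (1 - M.γ)⁻¹) ∧
      (Integrable (fun ω => M.violation (R.avg ω)) μ ∧
        ∫ ω, M.violation (R.avg ω) ∂μ ≤ (1 - M.γ) * ε / (1 + c * σ) ∧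
        (1 - M.γ) * ε / (1 + c * σ) ≤ (1 - M.γ) * ε) ∧
      ∀ lamStar : S → A → ℝ, M.IsOptimal c ρ lamStar →
        Integrable (fun ω => M.objective c ρ lamStar - M.objective c ρ (R.avg ω)) μ ∧
        ∫ ω, (M.objective c ρ lamStar - M.objective c ρ (R.avg ω)) ∂μ ≤ ε := by
  -- With K = 1000², the constant 243 = 133 + 110 enters as 243(1 + cσ)/(1000(1 + 2cσ)) ≤ 1/2.
  refine ⟨1000 ^ 2, by norm_num, ?_⟩
  intro S A _ _ _ _ hcard M c σ δ ε hc hδ hε D ρ hρ T hT Ω _ μ _ R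
  have : Nonempty S := Fintype.card_pos_iff.1 (Nat.pos_of_ne_zero fun h => by simp [h] at hcard)
  have : Nonempty A := Fintype.card_pos_iff.1 (Nat.pos_of_ne_zero fun h => by simp [h] at hcard)
  have hγ : 0 < 1 - M.γ := by linarith [M.γ_lt_one]
  have hcσ : 0 ≤ c * σ := mul_nonneg hc.le (hρ.nonneg M.γ_lt_one)
  have hn2 : 2 ≤ numSA S A := by
    unfold numSA
    exact_mod_cast hcard
  have hn : 1 < numSA S A := by linarith
  have hn0 : 0 < numSA S A := by linarith
  have hL := Real.log_pos hn
  have hC2 : 0 < 1 + 2 * c * σ := by linarith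
  have hT' : (0 : ℝ) < T := lt_of_lt_of_le (by positivity) hT
  have hT0 : 0 < T := by exact_mod_cast hT'
  have hB : 0 < (1 + c * σ) / (1 - M.γ) := by positivity
  have hrate : 243 * (1 + c * σ) / (1 - M.γ) ^ 2 * √(T * numSA S A * Real.log (numSA S A)) ≤
      T * (ε / 2) := by
    have h1 : √(T * numSA S A * Real.log (numSA S A)) ≤
        T * ((1 - M.γ) ^ 2 * ε / (1000 * (1 + 2 * c * σ))) := by
      rw [Real.sqrt_le_left (by positivity)]
      have h2 : 1000 ^ 2 * (numSA S A * Real.log (numSA S A) * (1 + 2 * c * σ) ^ 2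
          / ((1 - M.γ) ^ 4 * ε ^ 2)) * (T * ((1 - M.γ) ^ 2 * ε / (1000 * (1 + 2 * c * σ))) ^ 2) =
          T * numSA S A * Real.log (numSA S A) := by
        field_simp
      rw [← h2]
      refine (mul_le_mul_of_nonneg_right hT (by positivity)).trans (le_of_eq ?_)
      ring
    refine (mul_le_mul_of_nonneg_left h1 (by positivity)).trans ?_
    have h3 : 243 * (1 + c * σ) / (1 - M.γ) ^ 2 *
        (T * ((1 - M.γ) ^ 2 * ε / (1000 * (1 + 2 * c * σ)))) =
        T * (ε * ((243 * (1 + c * σ)) / (1000 * (1 + 2 * c * σ)))) := by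
      field_simp
    rw [h3, div_eq_mul_inv ε 2]
    gcongr
    rw [div_le_iff₀ (by positivity)]
    linarith
  have hgap : ∀ k ∈ M.feasible, ∫ ω, (M.objective c ρ k - M.objective c ρ (R.avg ω)) ∂μ
      + 2 * ((1 + c * σ) / (1 - M.γ)) * ∫ ω, M.violation (R.avg ω) ∂μ ≤ ε / 2 := fun k hk =>
    le_of_mul_le_mul_left ((R.integral_gap_le hρ hc.le hcσ hn2 hδ hT0 hk).trans hrate) hT'
  have hVI := R.integrable_violation hcσ hn hT0
  have hV0 : 0 ≤ ∫ ω, M.violation (R.avg ω) ∂μ :=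
    integral_nonneg fun ω => Finset.sum_nonneg fun _ _ => abs_nonneg _
  refine ⟨fun ω => R.avg_mem hcσ hn hT0 ω, ⟨hVI, ?_, ?_⟩, fun lamStar hopt =>
    ⟨R.integrable_objective_gap hρ hc.le hcσ hn hT0 hopt.1.1, ?_⟩⟩
  · obtain ⟨k₀, hk₀⟩ := M.feasible_nonempty
    have hbdd : BddAbove (M.objective c ρ '' M.feasible) := by
      refine ⟨M.objective c ρ k₀ + (1 + c * σ) * (2 * (1 - M.γ)⁻¹), ?_⟩
      rintro _ ⟨k, hk, rfl⟩
      have h1 := M.objective_sub_le hc.le hρ hk.1 hk₀.1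
      have h2 := mul_le_mul_of_nonneg_left (norm1_sub_le hk.1 hk₀.1)
        (by linarith : 0 ≤ 1 + c * σ)
      linarith
    -- The violation bound does not presuppose an optimal solution; a feasible array within ε/2 of
    -- the supremum suffices.
    obtain ⟨_, ⟨k, hk, rfl⟩, hkopt⟩ := exists_lt_of_lt_csSup (⟨_, k₀, hk₀, rfl⟩ :
      (M.objective c ρ '' M.feasible).Nonempty)
      (sub_lt_self (sSup (M.objective c ρ '' M.feasible)) (half_pos hε))
    have hG := R.integrable_objective_gap hρ hc.le hcσ hn hT0 hk.1
    have hlower : ∀ ω, -(ε / 2) ≤ M.objective c ρ k - M.objective c ρ (R.avg ω)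
        + (1 + c * σ) / (1 - M.γ) * M.violation (R.avg ω) := fun ω => by
      obtain ⟨l, hl, hle⟩ := M.exists_feasible_objective_ge hc.le hρ (R.avg_mem hcσ hn hT0 ω)
      have := le_csSup hbdd ⟨l, hl, rfl⟩
      linarith
    have h2 : ∫ _, -(ε / 2) ∂μ ≤ _ := integral_mono (integrable_const _)
      (hG.add (hVI.const_mul ((1 + c * σ) / (1 - M.γ)))) hlower
    rw [integral_add' hG (hVI.const_mul _), integral_const_mul, integral_const, probReal_univ,
      one_smul] at h2
    have h3 := hgap k hk
    -- The gap bound carries twice the violation weight and the exact penalty uses one copy; the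
    -- difference leaves ε/2 + ε/2.
    have h4 : (1 + c * σ) / (1 - M.γ) * ∫ ω, M.violation (R.avg ω) ∂μ ≤ ε := by linarith
    rw [le_div_iff₀ (by positivity)]
    rw [div_mul_eq_mul_div, div_le_iff₀ hγ] at h4
    linarith
  · exact div_le_self (by positivity) (by linarith)
  · have h1 := hgap lamStar hopt.1
    have h2 := mul_nonneg (mul_nonneg zero_le_two hB.le) hV0
    linarith
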